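/- Let $\sigma>0$. There is a constant $C>0$ depending only on $\sigma$ such that the following holds. Let $\Omega\subset\mathbb R^3$ be a bounded open polyhedral set, i.e. the interior of a finite union of tetrahedra, and let $\mathcal T_H$ and $\mathcal T_h$ be conforming triangulations of $\Omega$ into tetrahedra such that $\mathcal T_h$ is a refinement of $\mathcal T_H$ and both are shape regular with constant $\sigma$: every $K\in\mathcal T_H\cup\mathcal T_h$, of diameter $h_K$, contains a ball of diameter at least $h_K/\sigma$. Let $\boldsymbol V_h^{\rm CR}$ be the Crouzeix–Raviart space of all $\boldsymbol\psi_h\in L^2(\Omega;\mathbb R^3)$ that are affine on every $K\in\mathcal T_h$ and satisfy $\int_F[\![\boldsymbol\psi_h]\!]\,ds=\boldsymbol 0$ for every face $F$ of $\mathcal T_h$ (the jump being the trace of $\boldsymbol\psi_h$ if $F\subset\partial\Omega$), and let $|\boldsymbol\psi_h|_{1,h}^2=\sum_{K\in\mathcal T_h}\|\nabla\boldsymbol\psi_h\|_{0,K}^2$, where $\|\cdot\|_{0,K}$ is the norm of $L^2(K)$. Let $\boldsymbol V_H^d$ be the lowest-order Raviart–Thomas space of all $\boldsymbol v\in \boldsymbol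 H_0(\mathrm{div},\Omega)$ with $\boldsymbol v|_K\in\{\boldsymbol a+b\boldsymbol x:\boldsymbol a\in\mathbb R^3,\ b\in\mathbb R\}$ for every $K\in\mathcal T_H$, membership in $\boldsymbol H_0(\mathrm{div},\Omega)$ meaning for such piecewise polynomial fields that the normal component is continuous across interior faces and vanishes on the faces contained in $\partial\Omega$. Then for every $\boldsymbol\psi_h\in\boldsymbol V_h^{\rm CR}$ the nodal interpolant $\boldsymbol I_H^d\boldsymbol\psi_h\in\boldsymbol V_H^d$, determined by $$\int_F \boldsymbol I_H^d\boldsymbol\psi_h\cdot\boldsymbol n\,ds=\int_F\boldsymbol\psi_h\cdot\boldsymbol n\,ds\quad\text{for every face } F \text{ of } \mathcal T_H$$ (with traces taken from either side), exists, and $$\sum_{K\in\mathcal T_H}h_K^{-2}\,\|\boldsymbol\psi_h-\boldsymbol I_H^d\boldsymbol\psi_h\|_{0,K}^2\le C\,|\boldsymbol\psi_h|_{1,h}^2 .$$ -/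

import Mathlib

open MeasureTheory

noncomputable section

/-- Three-dimensional Euclidean space. -/
abbrev E3 : Type := EuclideanSpace ℝ (Fin 3)

/-- A conforming triangulation of the set `Ω ⊆ ℝ³` into finitely many nondegenerate closed
tetrahedra. It is a finite geometric simplicial complex (a simplex is given by its vertex set, the
vertices of a simplex are affinely independent, and two simplices meet in the hull of their common
vertices) in which every simplex is a vertex, edge or face of a tetrahedron or is a tetrahedron,
and `Ω` is the interior of the union of the tetrahedra. So `Ω` is automatically a bounded open
polyhedral set whose closure is that union. -/
structure Triangulation (Ω : Set E3) where
  /-- the underlying simplicial complex -/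
  complex : Geometry.SimplicialComplex ℝ E3
  finite_faces : complex.faces.Finite
  pure : ∀ s ∈ complex.faces, ∃ t ∈ complex.faces, s ⊆ t ∧ t.card = 4
  interior_space : interior complex.space = Ω

/-- The closed simplex spanned by a finite set of points. -/
def simplex (s : Finset E3) : Set E3 := convexHull ℝ (s : Set E3)

/-- The diameter `h_K` of a simplex. -/
def simplexDiam (K : Finset E3) : ℝ := Metric.diam (simplex K)

/-- `n` is a unit normal vector of the face with vertex set `F`. -/
def IsUnitNormal (F : Finset E3) (n : E3) : Prop :=
  ‖n‖ = 1 ∧ ∀ x ∈ F, ∀ y ∈ F, inner ℝ n (x - y) = 0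

/-- The trace of `u` on the boundary of the tetrahedron `K`, taken from inside: at `x ∈ ∂K` it is
the limit of `u y` as `y → x` with `y` in the interior of `K`. -/
def traceFrom (K : Finset E3) (u : E3 → E3) : E3 → E3 := extendFrom (interior (simplex K)) u

namespace Triangulation

variable {Ω : Set E3}

/-- The tetrahedra of the triangulation (as vertex sets). -/
def cells (T : Triangulation Ω) : Finset (Finset E3) :=
  T.finite_faces.toFinset.filter fun s => s.card = 4

/-- The two-dimensional faces (triangles) of the triangulation (as vertex sets). -/
def triangles (T : Triangulation Ω) : Finset (Finset E3) :=
  T.finite_faces.toFinset.filter fun s => s.card = 3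

/-- Shape regularity with constant `σ`: every tetrahedron `K` satisfies `h_K ≤ σ ρ_K`, where `ρ_K`
is the diameter of a largest ball contained in `K`. -/
def ShapeRegular (T : Triangulation Ω) (σ : ℝ) : Prop :=
  ∀ K ∈ T.cells, ∃ (c : E3) (r : ℝ), 0 < r ∧ Metric.closedBall c r ⊆ simplex K ∧
    simplexDiam K ≤ σ * (2 * r)

/-- `Th` is a refinement of `TH` (both triangulate the same `Ω`): every tetrahedron of `Th` is
contained in a tetrahedron of `TH`. -/
def IsRefinement (Th TH : Triangulation Ω) : Prop :=
  ∀ K' ∈ Th.cells, ∃ K ∈ TH.cells, simplex K' ⊆ simplex K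

/-- The Crouzeix–Raviart space: `ψ` is affine on (the interior of) every tetrahedron, the mean of
its jump over every interior face is zero, and the mean of its trace over every face on `∂Ω` is
zero. Values on the skeleton of the mesh, a null set, are irrelevant. Surface integrals are
with respect to the two-dimensional Euclidean Hausdorff measure, which is surface area. -/
structure IsCrouzeixRaviart (T : Triangulation Ω) (ψ : E3 → E3) : Prop where
  affine : ∀ K ∈ T.cells, ∃ p : E3 →ᵃ[ℝ] E3, Set.EqOn ψ p (interior (simplex K))
  jump_interior : ∀ F ∈ T.triangles, ∀ K₁ ∈ T.cells, ∀ K₂ ∈ T.cells, K₁ ≠ K₂ → F ⊆ K₁ → F ⊆ K₂ →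
    ∫ x in simplex F, (traceFrom K₁ ψ x - traceFrom K₂ ψ x) ∂μHE[2] = 0
  jump_boundary : ∀ F ∈ T.triangles, simplex F ⊆ frontier Ω → ∀ K ∈ T.cells, F ⊆ K →
    ∫ x in simplex F, traceFrom K ψ x ∂μHE[2] = 0

/-- The squared broken seminorm `|ψ|²_{1,h}`: the sum over all tetrahedra of the squared `L²` norm
of the (Frobenius norm of the) elementwise gradient. -/
def brokenSeminormSq (T : Triangulation Ω) (ψ : E3 → E3) : ℝ :=
  ∑ K ∈ T.cells, ∫ x in interior (simplex K),
    ∑ i : Fin 3, ‖fderiv ℝ ψ x (EuclideanSpace.single i 1)‖ ^ 2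

/-- The lowest-order Raviart–Thomas space: `v` has the form `a + b x` with `a ∈ ℝ³`, `b ∈ ℝ` on
(the interior of) every tetrahedron, and `v ∈ H₀(div, Ω)`, which for such piecewise polynomial
fields means that the normal component is continuous across the interior faces and vanishes on the
faces on `∂Ω`. -/
structure IsRaviartThomas (T : Triangulation Ω) (v : E3 → E3) : Prop where
  shape : ∀ K ∈ T.cells, ∃ (a : E3) (b : ℝ), Set.EqOn v (fun x => a + b • x) (interior (simplex K))
  normal_interior : ∀ F ∈ T.triangles, ∀ n, IsUnitNormal F n →
    ∀ K₁ ∈ T.cells, ∀ K₂ ∈ T.cells, F ⊆ K₁ → F ⊆ K₂ →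
    ∀ x ∈ simplex F, inner ℝ (traceFrom K₁ v x) n = inner ℝ (traceFrom K₂ v x) n
  normal_boundary : ∀ F ∈ T.triangles, simplex F ⊆ frontier Ω → ∀ n, IsUnitNormal F n →
    ∀ K ∈ T.cells, F ⊆ K → ∀ x ∈ simplex F, inner ℝ (traceFrom K v x) n = 0

/-- `v` is the nodal Raviart–Thomas interpolant `I^d u` of `u`: it belongs to the Raviart–Thomas
space, and on every face of every tetrahedron it has the same normal flux as `u` (whose trace
has to be integrable there). These fluxes determine `v` on the interior of every tetrahedron. -/
structure IsRTInterpolant (T : Triangulation Ω) (u v : E3 → E3) : Prop where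
  mem : T.IsRaviartThomas v
  integrable : ∀ K ∈ T.cells, ∀ F ∈ T.triangles, F ⊆ K →
    IntegrableOn (traceFrom K u) (simplex F) μHE[2]
  flux : ∀ K ∈ T.cells, ∀ F ∈ T.triangles, F ⊆ K → ∀ n, IsUnitNormal F n →
    ∫ x in simplex F, inner ℝ (traceFrom K v x) n ∂μHE[2]
      = ∫ x in simplex F, inner ℝ (traceFrom K u x) n ∂μHE[2]

end Triangulation

end

/-! The estimate is local. On a coarse tetrahedron `K` of diameter R, both `ψ` and its interpolant
`v` are compared with the mean m of `ψ` over `K`. As `ψ` jumps across fine faces and `K` may contain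
arbitrarily many fine cells, the Poincaré and trace inequalities for `ψ` are derived from a discrete
Riesz potential of its gradient.

Fix y in `K` off the fine edges. For almost every z in `K` the segment from y to z avoids the edges,
so it passes between cells only through faces, where the jump has mean zero and is bounded by h|∇ψ|
on the two neighbours. Hence |ψ(y) - ψ(z)| is at most 6 times the sum of h_A|∇ψ_A| over the cells A
that the segment meets (`norm_piece_sub_piece_le`). A cell A is met only if z lies in its shadow,
whose volume is at most a multiple of R³(h_A/(h_A+|y-x_A|))² with x_A a vertex of A
(`exists_shadow`). Averaging over z bounds |ψ(y) - m| by a multiple of `potential`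
(`norm_piece_sub_average_le`).

A Cauchy–Schwarz inequality with unevenly split kernel then gives `integral_sq_potential_le`: if
balls of radius r have μ-measure at most M r^k with k > 3/2, the integral of the squared potential
is at most a multiple of M R^(k-1) Σ h_A³|∇ψ_A|². Volume (k = 3) yields the Poincaré inequality and
surface area (k = 2) the trace inequality on faces.

The normal component of `v` on a face is constant and equals the face mean of that of `ψ`, so (v -
m)·n is controlled by the trace inequality. Shape regularity recovers v - m at a vertex from the
three normal components there, and affinity extends the bound to `K` (`sq_norm_sub_average_le`).

The interpolant exists because a coarse face is, up to edges, a union of fine triangles, each shared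
by fine cells on both sides. Mean jumps thus vanish across coarse faces too, and the fluxes are
single-valued. -/

/-! ### Barycentric coordinates, normals and heights of a tetrahedron. -/

/-- The vertex sets of nondegenerate tetrahedra. -/
structure IsTet (K : Finset E3) : Prop where
  card : K.card = 4
  indep : AffineIndependent ℝ ((↑) : K → E3)

namespace IsTet

variable {K G : Finset E3}

/-- The affine basis formed by the vertices of a tetrahedron. -/
noncomputable def basis (h : IsTet K) : AffineBasis K ℝ E3 :=
  ⟨(↑), h.indep, by
    rw [h.indep.affineSpan_eq_top_iff_card_eq_finrank_add_one]
    simp [h.card]⟩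

lemma coe_basis (h : IsTet K) (i : K) : h.basis i = (i : E3) := rfl

open Classical in
/-- The barycentric coordinate of the vertex `p` of the tetrahedron `K`. -/
noncomputable def bary (h : IsTet K) (p : E3) : E3 →ᵃ[ℝ] ℝ :=
  if hp : p ∈ K then h.basis.coord ⟨p, hp⟩ else 0

lemma bary_coe (h : IsTet K) (i : K) : h.bary i = h.basis.coord i := by
  simp [bary]

lemma bary_self (h : IsTet K) {p : E3} (hp : p ∈ K) : h.bary p p = 1 := by
  lift p to K using hp
  rw [bary_coe, ← h.coe_basis p]
  simp

lemma bary_of_ne (h : IsTet K) {p q : E3} (hq : q ∈ K) (hpq : q ≠ p) : h.bary p q = 0 := by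
  by_cases hp : p ∈ K
  · lift p to K using hp
    lift q to K using hq
    rw [bary_coe, ← h.coe_basis q]
    exact h.basis.coord_apply_ne (fun e => hpq (by rw [e]))
  · simp [bary, hp]

lemma sum_bary (h : IsTet K) (x : E3) : ∑ p ∈ K, h.bary p x = 1 := by
  rw [← Finset.sum_coe_sort, ← h.basis.sum_coord_apply_eq_one x]
  exact Finset.sum_congr rfl fun i _ => by rw [bary_coe]

lemma sum_bary_smul (h : IsTet K) (x : E3) : ∑ p ∈ K, h.bary p x • p = x := by
  rw [← Finset.sum_coe_sort K fun p => h.bary p x • p]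
  conv_rhs => rw [← h.basis.linear_combination_coord_eq_self x]
  exact Finset.sum_congr rfl fun i _ => by rw [bary_coe, coe_basis]

lemma convexHull_range (h : IsTet K) : convexHull ℝ (Set.range h.basis) = simplex K := by
  rw [simplex]
  congr 1
  ext x
  simp [coe_basis]

lemma mem_simplex_iff (h : IsTet K) {x : E3} : x ∈ simplex K ↔ ∀ p ∈ K, 0 ≤ h.bary p x := by
  rw [← h.convexHull_range, h.basis.convexHull_eq_nonneg_coord]
  constructor
  · intro H p hp
    have := H ⟨p, hp⟩
    rwa [← h.bary_coe] at this
  · intro H i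
    have := H i i.2
    rwa [h.bary_coe] at this

lemma mem_interior_iff (h : IsTet K) {x : E3} :
    x ∈ interior (simplex K) ↔ ∀ p ∈ K, 0 < h.bary p x := by
  rw [← h.convexHull_range, h.basis.interior_convexHull]
  constructor
  · intro H p hp
    have := H ⟨p, hp⟩
    rwa [← h.bary_coe] at this
  · intro H i
    have := H i i.2
    rwa [h.bary_coe] at this

lemma bary_le_one (h : IsTet K) {x : E3} (hx : x ∈ simplex K) (p : E3) : h.bary p x ≤ 1 := by
  by_cases hp : p ∈ K
  · rw [← h.sum_bary x]
    exact Finset.single_le_sum (f := fun p => h.bary p x) (h.mem_simplex_iff.1 hx) hp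
  · simp [bary, hp]

/-- An affine map is determined by its values at the vertices. -/
lemma map_eq_sum (h : IsTet K) {V : Type*} [AddCommGroup V] [Module ℝ V] (f : E3 →ᵃ[ℝ] V)
    (x : E3) : f x = ∑ p ∈ K, h.bary p x • f p := by
  have key : ∀ z, f z = f.linear z + f 0 := fun z => by
    have := f.map_vadd 0 z
    simpa using this
  rw [key x]
  conv_lhs => rw [← h.sum_bary_smul x]
  simp only [map_sum, map_smul]
  conv_rhs => rw [Finset.sum_congr rfl fun p _ => by rw [key p, smul_add]]
  rw [Finset.sum_add_distrib, ← Finset.sum_smul, h.sum_bary, one_smul]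

lemma mem_face_iff (h : IsTet K) (hG : G ⊆ K) {x : E3} :
    x ∈ simplex G ↔ x ∈ simplex K ∧ ∀ p ∈ K, p ∉ G → h.bary p x = 0 := by
  constructor
  · intro hx
    refine ⟨convexHull_mono (by exact_mod_cast hG) hx, fun p hp hpG => ?_⟩
    have hc : Convex ℝ {x : E3 | h.bary p x = 0} := by
      have := (convex_singleton (0 : ℝ)).affine_preimage (h.bary p)
      exact this
    refine convexHull_min ?_ hc hx
    intro q hq
    exact h.bary_of_ne (hG hq) (fun e => hpG (e ▸ hq))
  · rintro ⟨hx, h0⟩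
    rw [h.mem_simplex_iff] at hx
    have e1 : ∑ p ∈ G, h.bary p x = 1 := by
      rw [← h.sum_bary x]
      exact Finset.sum_subset hG fun p hp hpG => h0 p hp hpG
    have e2 : ∑ p ∈ G, h.bary p x • p = x := by
      conv_rhs => rw [← h.sum_bary_smul x]
      exact Finset.sum_subset hG fun p hp hpG => by rw [h0 p hp hpG, zero_smul]
    rw [← e2]
    exact (convex_convexHull ℝ _).sum_mem (fun p hp => hx p (hG hp)) e1
      fun p hp => subset_convexHull ℝ _ hp

lemma interior_nonempty (h : IsTet K) : (interior (simplex K)).Nonempty := by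
  rw [← h.convexHull_range]
  exact ⟨_, h.basis.centroid_mem_interior_convexHull⟩

end IsTet

lemma convex_simplex (K : Finset E3) : Convex ℝ (simplex K) := convex_convexHull ℝ _

lemma isCompact_simplex (K : Finset E3) : IsCompact (simplex K) :=
  K.finite_toSet.isCompact_convexHull ℝ

lemma isClosed_simplex (K : Finset E3) : IsClosed (simplex K) := (isCompact_simplex K).isClosed

lemma measurableSet_simplex (K : Finset E3) : MeasurableSet (simplex K) :=
  (isClosed_simplex K).measurableSet

lemma simplex_mono {K G : Finset E3} (h : G ⊆ K) : simplex G ⊆ simplex K :=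
  convexHull_mono (by exact_mod_cast h)

lemma subset_simplex {K : Finset E3} {p : E3} (h : p ∈ K) : p ∈ simplex K :=
  subset_convexHull ℝ _ h

lemma dist_le_simplexDiam {K : Finset E3} {x y : E3} (hx : x ∈ simplex K) (hy : y ∈ simplex K) :
    ‖x - y‖ ≤ simplexDiam K := by
  rw [← dist_eq_norm]
  exact Metric.dist_le_diam_of_mem (isCompact_simplex K).isBounded hx hy

namespace IsTet

variable {K : Finset E3}

lemma closure_interior (h : IsTet K) : closure (interior (simplex K)) = simplex K := by
  rw [(convex_simplex K).closure_interior_eq_closure_of_nonempty_interior (𝕜 := ℝ)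
      h.interior_nonempty,
    (isClosed_simplex K).closure_eq]

lemma diam_pos (h : IsTet K) : 0 < simplexDiam K := by
  have : 1 < K.card := by rw [h.card]; norm_num
  obtain ⟨a, ha, b, hb, hab⟩ := Finset.one_lt_card.1 this
  exact lt_of_lt_of_le (norm_pos_iff.2 (sub_ne_zero.2 hab))
    (dist_le_simplexDiam (subset_simplex ha) (subset_simplex hb))

lemma continuous_bary (h : IsTet K) (p : E3) : Continuous (h.bary p) :=
  (h.bary p).continuous_of_finiteDimensional

/-- The signed distance to the plane of a face is a multiple of a barycentric coordinate. -/
lemma inner_sub_eq (h : IsTet K) {p q n : E3} (hp : p ∈ K) (hq : q ∈ K.erase p)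
    (hn : IsUnitNormal (K.erase p) n) (x : E3) :
    inner ℝ n (x - q) = inner ℝ n (p - q) * h.bary p x := by
  let f : E3 →ᵃ[ℝ] ℝ := (innerSL ℝ n).toLinearMap.toAffineMap.comp
    (AffineMap.id ℝ E3 - AffineMap.const ℝ E3 q)
  have hf : ∀ z, f z = inner ℝ n (z - q) := fun z => by simp [f]
  -- The affine function `f` vanishes at every vertex other than `p`.
  rw [← hf, h.map_eq_sum f x, Finset.sum_eq_single_of_mem p hp]
  · rw [hf, smul_eq_mul, mul_comm]
  · intro b hb hbp
    rw [hf, hn.2 b (Finset.mem_erase.2 ⟨hbp, hb⟩) q hq, smul_zero]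

lemma inner_ne_zero (h : IsTet K) {p q n : E3} (hp : p ∈ K) (hq : q ∈ K.erase p)
    (hn : IsUnitNormal (K.erase p) n) : inner ℝ n (p - q) ≠ 0 := by
  intro h0
  -- A unit step along `n` changes the left side by 1, so the factor cannot vanish.
  have := h.inner_sub_eq hp hq hn (q + n)
  rw [h0, add_sub_cancel_left, real_inner_self_eq_norm_sq, hn.1] at this
  norm_num at this

/-- The height of a tetrahedron is at least the diameter of an inscribed ball. -/
lemma two_mul_le_abs_inner (h : IsTet K) {p q n c : E3} {r : ℝ} (hr : 0 < r)
    (hb : Metric.closedBall c r ⊆ simplex K) (hp : p ∈ K) (hq : q ∈ K.erase p)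
    (hn : IsUnitNormal (K.erase p) n) : 2 * r ≤ |inner ℝ n (p - q)| := by
  -- These two antipodal points of the ball are 2r apart along `n`, while their barycentric
  -- coordinates at `p` differ by at most 1.
  have m1 : c + r • n ∈ simplex K := hb (by simp [norm_smul, hn.1, abs_of_pos hr])
  have m2 : c - r • n ∈ simplex K := hb (by simp [norm_smul, hn.1, abs_of_pos hr])
  have e1 := h.inner_sub_eq hp hq hn (c + r • n)
  have e2 := h.inner_sub_eq hp hq hn (c - r • n)
  have e3 : inner ℝ n (c + r • n - q) - inner ℝ n (c - r • n - q) = 2 * r := by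
    rw [← inner_sub_right]
    have : c + r • n - q - (c - r • n - q) = (2 * r) • n := by module
    rw [this, inner_smul_right, real_inner_self_eq_norm_sq, hn.1]
    ring
  have b1 := h.mem_simplex_iff.1 m1 p hp
  have b2 := h.mem_simplex_iff.1 m2 p hp
  have b3 := h.bary_le_one m1 p
  have b4 := h.bary_le_one m2 p
  rw [e1, e2, ← mul_sub] at e3
  rw [← abs_of_pos (by positivity : (0:ℝ) < 2 * r), ← e3, abs_mul]
  exact mul_le_of_le_one_right (abs_nonneg _) (abs_le.2 ⟨by linarith, by linarith⟩)

/-- The normal is the normalised gradient of the barycentric coordinate at `p`, which is constant on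
the opposite face. -/
lemma exists_unitNormal (h : IsTet K) {p : E3} (hp : p ∈ K) :
    ∃ n, IsUnitNormal (K.erase p) n := by
  obtain ⟨q, hq⟩ : (K.erase p).Nonempty := by
    rw [← Finset.card_pos, Finset.card_erase_of_mem hp, h.card]; norm_num
  set G := (InnerProductSpace.toDual ℝ E3).symm (LinearMap.toContinuousLinearMap (h.bary p).linear)
    with hG
  have hin : ∀ x y : E3, inner ℝ G (x - y) = h.bary p x - h.bary p y := fun x y => by
    rw [hG, InnerProductSpace.toDual_symm_apply]
    exact (h.bary p).linearMap_vsub x y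
  have hG0 : G ≠ 0 := by
    intro h0
    have := hin p q
    rw [h0, inner_zero_left, h.bary_self hp,
      h.bary_of_ne (Finset.mem_of_mem_erase hq) (Finset.ne_of_mem_erase hq)] at this
    norm_num at this
  refine ⟨‖G‖⁻¹ • G, ?_, ?_⟩
  · rw [norm_smul, norm_inv, norm_norm, inv_mul_cancel₀ (norm_ne_zero_iff.2 hG0)]
  · intro x hx y hy
    rw [inner_smul_left, hin, h.bary_of_ne (Finset.mem_of_mem_erase hx) (Finset.ne_of_mem_erase hx),
      h.bary_of_ne (Finset.mem_of_mem_erase hy) (Finset.ne_of_mem_erase hy)]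
    simp

/-- Unit normals of a face are unique up to a scalar factor. -/
lemma unitNormal_unique (h : IsTet K) {p n n' : E3} (hp : p ∈ K)
    (hn : IsUnitNormal (K.erase p) n) (hn' : IsUnitNormal (K.erase p) n') :
    ∃ c : ℝ, n' = c • n := by
  obtain ⟨q, hq⟩ : (K.erase p).Nonempty := by
    rw [← Finset.card_pos, Finset.card_erase_of_mem hp, h.card]; norm_num
  refine ⟨inner ℝ n' (p - q) / inner ℝ n (p - q), ?_⟩
  refine ext_inner_right ℝ fun v => ?_
  have e1 := h.inner_sub_eq hp hq hn (q + v)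
  have e2 := h.inner_sub_eq hp hq hn' (q + v)
  rw [add_sub_cancel_left] at e1 e2
  rw [inner_smul_left, e1, e2]
  have := h.inner_ne_zero hp hq hn
  simp only [conj_trivial]
  field_simp

/-- A vector is controlled by its components normal to the three faces at a vertex. -/
lemma norm_le_of_inner_le (h : IsTet K) {c u j : E3} {r e : ℝ} (hr : 0 < r)
    (hb : Metric.closedBall c r ⊆ simplex K) (hj : j ∈ K)
    (hu : ∀ p ∈ K, p ≠ j → ∃ n, IsUnitNormal (K.erase p) n ∧ |inner ℝ n u| ≤ e) :
    ‖u‖ ≤ 4 * (e / (2 * r) * simplexDiam K) := by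
  have he : 0 ≤ e := by
    have : 1 < K.card := by rw [h.card]; norm_num
    obtain ⟨p, hp, hpj⟩ := Finset.exists_mem_ne this j
    obtain ⟨n, -, hn⟩ := hu p hp hpj
    exact (abs_nonneg _).trans hn
  have hd := h.diam_pos
  -- Expansion of `u` along the three edges at `j`. The coefficient of p - j is the ratio of the
  -- components of `u` and p - j normal to the face opposite `p`, and the denominator is a height.
  -- The term p = j is zero but is counted in the factor 4.
  have key : u = ∑ p ∈ K, h.bary p (j + u) • (p - j) := by
    simp only [smul_sub]
    rw [Finset.sum_sub_distrib, h.sum_bary_smul, ← Finset.sum_smul, h.sum_bary]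
    module
  have hterm : ∀ p ∈ K, ‖h.bary p (j + u) • (p - j)‖ ≤ e / (2 * r) * simplexDiam K := by
    intro p hp
    by_cases hpj : p = j
    · rw [hpj, sub_self, smul_zero, norm_zero]; positivity
    · obtain ⟨n, hn, hnu⟩ := hu p hp hpj
      have hje : j ∈ K.erase p := Finset.mem_erase.2 ⟨fun e => hpj e.symm, hj⟩
      have e1 := h.inner_sub_eq hp hje hn (j + u)
      rw [add_sub_cancel_left] at e1
      have hD := h.two_mul_le_abs_inner hr hb hp hje hn
      rw [norm_smul]
      refine mul_le_mul ?_ (dist_le_simplexDiam (subset_simplex hp) (subset_simplex hj))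
        (norm_nonneg _) (by positivity)
      rw [Real.norm_eq_abs, le_div_iff₀ (by positivity)]
      rw [e1, abs_mul] at hnu
      calc |h.bary p (j + u)| * (2 * r)
          ≤ |h.bary p (j + u)| * |inner ℝ n (p - j)| := by gcongr
        _ ≤ e := by rw [mul_comm]; exact hnu
  conv_lhs => rw [key]
  refine (norm_sum_le_of_le _ hterm).trans ?_
  rw [Finset.sum_const, h.card]
  norm_num

/-- Each face of a tetrahedron contains a disc as large as an inscribed ball. -/
lemma exists_disc_subset_face (h : IsTet K) {p c : E3} {r : ℝ} (hr : 0 < r)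
    (hb : Metric.closedBall c r ⊆ simplex K) (hp : p ∈ K) :
    ∃ a : E3, h.bary p a = 0 ∧
      ∀ x, h.bary p x = 0 → ‖x - a‖ ≤ r → x ∈ simplex (K.erase p) := by
  have hc : c ∈ interior (simplex K) :=
    interior_mono hb (Metric.ball_subset_interior_closedBall (Metric.mem_ball_self hr))
  rw [h.mem_interior_iff] at hc
  obtain ⟨q, hq⟩ : (K.erase p).Nonempty := by
    rw [← Finset.card_pos, Finset.card_erase_of_mem hp, h.card]; norm_num
  set l := h.bary p c with hl
  have hl1 : l < 1 := by
    rw [← h.sum_bary c, ← Finset.add_sum_erase K _ hp, ← hl]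
    have := Finset.sum_pos (s := K.erase p) (f := fun p => h.bary p c)
      (fun i hi => hc i (Finset.mem_of_mem_erase hi)) ⟨q, hq⟩
    linarith
  have hl0 : 0 < l := hc p hp
  have hs : 0 < 1 - l := by linarith
  -- Projection of the centre `c` from `p` onto the opposite face. The homothety at `p` with ratio
  -- (1 - l)⁻¹ ≥ 1 carries a section of the ball to a disc of radius at least `r` about `a`.
  set a := AffineMap.lineMap p c (1 - l)⁻¹ with ha
  have hpa : h.bary p a = 0 := by
    rw [ha, AffineMap.apply_lineMap, h.bary_self hp, ← hl, AffineMap.lineMap_apply]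
    simp only [vsub_eq_sub, smul_eq_mul, vadd_eq_add]
    field_simp
    ring
  refine ⟨a, hpa, fun x hx hxa => ?_⟩
  -- The preimage of `x` under the homothety lies in the ball.
  have hy : c + (1 - l) • (x - a) ∈ simplex K := hb (by
    rw [mem_closedBall_iff_norm, add_sub_cancel_left, norm_smul, Real.norm_eq_abs, abs_of_pos hs]
    calc (1 - l) * ‖x - a‖ ≤ 1 * ‖x - a‖ := by gcongr; linarith
      _ ≤ r := by linarith)
  have hxe : x = AffineMap.lineMap p (c + (1 - l) • (x - a)) (1 - l)⁻¹ := by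
    rw [AffineMap.lineMap_apply] at ha ⊢
    have hne := hs.ne'
    simp only [vsub_eq_sub, vadd_eq_add] at ha ⊢
    have : c + (1 - l) • (x - a) - p = (c - p) + (1 - l) • (x - a) := by abel
    rw [this, smul_add, smul_smul, inv_mul_cancel₀ hne, one_smul]
    have : (1 - l)⁻¹ • (c - p) = a - p := by rw [ha]; abel
    rw [this]; abel
  have hnn : ∀ i ∈ K, 0 ≤ h.bary i x := by
    intro i hi
    by_cases hip : i = p
    · rw [hip, hx]
    · rw [hxe, AffineMap.apply_lineMap, h.bary_of_ne hp (Ne.symm hip), AffineMap.lineMap_apply]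
      have := h.mem_simplex_iff.1 hy i hi
      simp only [vsub_eq_sub, smul_eq_mul, vadd_eq_add, sub_zero, add_zero]
      positivity
  rw [h.mem_face_iff (Finset.erase_subset _ _)]
  refine ⟨h.mem_simplex_iff.2 hnn, fun i hi hie => ?_⟩
  have : i = p := by
    by_contra hne
    exact hie (Finset.mem_erase.2 ⟨hne, hi⟩)
  rw [this, hx]

end IsTet

/-! ### Riesz potentials and shadows of balls. -/

open Metric in
/-- Dyadic estimate of the Riesz potential of a measure of dimension `k`. -/
lemma lintegral_inv_sqrt_norm_pow_le {μ : Measure E3} {c : E3} {M R : ℝ} {k a : ℕ} (ha : 0 < a)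
    (hak : a < 2 * k) (hM : 0 ≤ M) (hR : 0 < R)
    (hμ : ∀ r, 0 < r → μ (closedBall c r) ≤ ENNReal.ofReal (M * r ^ k)) :
    ∫⁻ y in closedBall c R, ENNReal.ofReal ((√‖y - c‖)⁻¹ ^ a) ∂μ
      ≤ ENNReal.ofReal (2 ^ (a + 1) * M * √R ^ (2 * k - a)) := by
  -- Bound of the kernel on the shell R/4^(j+1) < |y - c| ≤ R/4^j. Radii shrink by 4 so that their
  -- square roots shrink by 2.
  set w : ℕ → ℝ := fun j => (2 ^ (j + 1) / √R) ^ a with hw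
  have hw0 : ∀ j, 0 ≤ w j := fun j => by positivity
  have hsR : 0 < √R := Real.sqrt_pos.2 hR
  have hpt : ∀ y ∈ closedBall c R, ENNReal.ofReal ((√‖y - c‖)⁻¹ ^ a) ≤
      ∑' j, (closedBall c (R / 4 ^ j)).indicator (fun _ => ENNReal.ofReal (w j)) y := by
    intro y hy
    rcases eq_or_ne y c with rfl | hyc
    -- At the centre the left side is zero, since `0⁻¹ = 0` and `a` is positive.
    · simp [ha.ne']
    have hd : 0 < ‖y - c‖ := norm_pos_iff.2 (sub_ne_zero.2 hyc)
    have hdR : ‖y - c‖ ≤ R := mem_closedBall_iff_norm.1 hy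
    obtain ⟨j, hj1, hj2⟩ := exists_nat_pow_near (x := R / ‖y - c‖) (y := 4)
      ((one_le_div hd).2 hdR) (by norm_num)
    refine le_trans ?_ (ENNReal.le_tsum j)
    have hm : y ∈ closedBall c (R / 4 ^ j) := by
      rw [mem_closedBall_iff_norm, le_div_iff₀ (by positivity)]
      rw [le_div_iff₀ hd] at hj1
      linarith
    rw [Set.indicator_of_mem hm]
    refine ENNReal.ofReal_le_ofReal (pow_le_pow_left₀ (by positivity) ?_ a)
    rw [inv_eq_one_div, div_le_div_iff₀ (Real.sqrt_pos.2 hd) hsR, one_mul]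
    have h4 : (2 : ℝ) ^ (j + 1) = √(4 ^ (j + 1)) := by
      rw [show (4 : ℝ) = 2 ^ 2 by norm_num, ← pow_mul, mul_comm, pow_mul,
        Real.sqrt_sq (by positivity)]
    rw [h4, ← Real.sqrt_mul (by positivity)]
    exact Real.sqrt_le_sqrt ((div_lt_iff₀ hd).1 hj2).le
  calc ∫⁻ y in closedBall c R, ENNReal.ofReal ((√‖y - c‖)⁻¹ ^ a) ∂μ
      ≤ ∫⁻ y in closedBall c R, ∑' j, (closedBall c (R / 4 ^ j)).indicator
          (fun _ => ENNReal.ofReal (w j)) y ∂μ := setLIntegral_mono' measurableSet_closedBall hpt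
    _ ≤ ∫⁻ y, ∑' j, (closedBall c (R / 4 ^ j)).indicator
          (fun _ => ENNReal.ofReal (w j)) y ∂μ := setLIntegral_le_lintegral _ _
    _ = ∑' j, ENNReal.ofReal (w j) * μ (closedBall c (R / 4 ^ j)) := by
        rw [lintegral_tsum fun j =>
          (measurable_const.indicator measurableSet_closedBall).aemeasurable]
        exact tsum_congr fun j => lintegral_indicator_const measurableSet_closedBall _
    _ ≤ ∑' j : ℕ, ENNReal.ofReal (2 ^ a * M * √R ^ (2 * k - a) * (1 / 2) ^ j) := by
        refine ENNReal.tsum_le_tsum fun j => ?_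
        refine (mul_le_mul_right (hμ _ (by positivity)) _).trans ?_
        rw [← ENNReal.ofReal_mul (hw0 j)]
        refine ENNReal.ofReal_le_ofReal ?_
        have hRk : R ^ k = √R ^ a * √R ^ (2 * k - a) := by
          rw [← pow_add, Nat.add_sub_cancel' hak.le, pow_mul, Real.sq_sqrt hR.le]
        -- The integrality gap a + 1 ≤ 2k gives the shells a geometric ratio of at most 1/2.
        have h2 : ((2 : ℝ) ^ j) ^ a * 2 ^ j ≤ (4 ^ j) ^ k := by
          rw [show (4 : ℝ) = 2 ^ 2 by norm_num, ← pow_mul, ← pow_mul, ← pow_mul, ← pow_add]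
          refine pow_le_pow_right₀ (by norm_num) ?_
          calc j * a + j = j * (a + 1) := by ring
            _ ≤ j * (2 * k) := Nat.mul_le_mul_left _ hak
            _ = 2 * (j * k) := by ring
        have e1 : w j * (M * (R / 4 ^ j) ^ k) =
            2 ^ a * M * √R ^ (2 * k - a) * ((2 ^ j) ^ a / (4 ^ j) ^ k) := by
          simp only [hw, div_pow, hRk]
          field_simp
          ring
        rw [e1]
        refine mul_le_mul_of_nonneg_left ?_ (by positivity)
        rw [one_div, inv_pow, div_le_iff₀ (by positivity), inv_mul_eq_div,
          le_div_iff₀ (by positivity)]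
        exact h2
    _ = ENNReal.ofReal (2 ^ (a + 1) * M * √R ^ (2 * k - a)) := by
        rw [← ENNReal.ofReal_tsum_of_nonneg (fun j => by positivity)
          (summable_geometric_two.mul_left _), tsum_mul_left, tsum_geometric_two]
        congr 1
        ring

/-- The square root of `h / (h + |y - c|)`, a weight that measures how small a set of size `h` near
`c` looks from `y`. -/
noncomputable def aspect (h : ℝ) (c y : E3) : ℝ := √(h / (h + ‖y - c‖))

lemma aspect_nonneg (h : ℝ) (c y : E3) : 0 ≤ aspect h c y := Real.sqrt_nonneg _

lemma aspect_le_one {h : ℝ} (hh : 0 < h) (c y : E3) : aspect h c y ≤ 1 :=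
  Real.sqrt_le_one.2 ((div_le_one (by positivity)).2 (by linarith [norm_nonneg (y - c)]))

lemma continuous_aspect {h : ℝ} (hh : 0 < h) (c : E3) : Continuous (aspect h c) := by
  unfold aspect
  refine Real.continuous_sqrt.comp (continuous_const.div (by fun_prop) fun y => ?_)
  have := norm_nonneg (y - c)
  positivity

/-- The free `d` can be the distance from `y` to `c` or, by the triangle inequality, to any other
point within `h` of `c`. -/
lemma aspect_le {h d : ℝ} (hh : 0 < h) {c y : E3} (hd : d ≤ h + ‖y - c‖) (hd0 : 0 < d) :
    aspect h c y ≤ √h * (√d)⁻¹ := by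
  rw [aspect, Real.sqrt_div hh.le, div_eq_mul_inv]
  gcongr

lemma aspect_pow_four {h : ℝ} (hh : 0 < h) (c y : E3) :
    aspect h c y ^ 4 = (h / (h + ‖y - c‖)) ^ 2 := by
  rw [show 4 = 2 * 2 by norm_num, pow_mul, aspect, Real.sq_sqrt (by positivity)]

lemma integrable_aspect_pow {μ : Measure E3} [IsFiniteMeasure μ] {h : ℝ} (hh : 0 < h) (c : E3)
    (m : ℕ) : Integrable (fun y => aspect h c y ^ m) μ :=
  Integrable.of_bound ((continuous_aspect hh c).pow m).aestronglyMeasurable 1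
    (.of_forall fun y => by
      rw [Real.norm_of_nonneg (pow_nonneg (aspect_nonneg _ _ _) _)]
      exact pow_le_one₀ (aspect_nonneg _ _ _) (aspect_le_one hh _ _))

/-- The weight is dominated by h^(3/2)|y - c|^(-3/2), which is integrable when k > 3/2. The point
`c` must be null because the kernel takes the value 0 there. -/
lemma integral_aspect_pow_three_le {μ : Measure E3} [IsFiniteMeasure μ] {c : E3} {M R h : ℝ} {k : ℕ}
    (hk : 3 < 2 * k) (hM : 0 ≤ M) (hR : 0 < R) (hh : 0 < h) (hc : μ {c} = 0)
    (hμ : ∀ r, 0 < r → μ (Metric.closedBall c r) ≤ ENNReal.ofReal (M * r ^ k))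
    (hsupp : ∀ᵐ y ∂μ, y ∈ Metric.closedBall c R) :
    ∫ y, aspect h c y ^ 3 ∂μ ≤ √h ^ 3 * (2 ^ 4 * M * √R ^ (2 * k - 3)) := by
  rw [integral_eq_lintegral_of_nonneg_ae
    (.of_forall fun y => pow_nonneg (aspect_nonneg _ _ _) _)
    ((continuous_aspect hh c).pow 3).aestronglyMeasurable]
  refine ENNReal.toReal_le_of_le_ofReal (by positivity) ?_
  have hne : ∀ᵐ y ∂μ, y ≠ c := by
    rw [ae_iff]; simpa using hc
  calc ∫⁻ y, ENNReal.ofReal (aspect h c y ^ 3) ∂μ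
      = ∫⁻ y in Metric.closedBall c R, ENNReal.ofReal (aspect h c y ^ 3) ∂μ := by
        rw [Measure.restrict_eq_self_of_ae_mem hsupp]
    _ ≤ ∫⁻ y in Metric.closedBall c R,
          ENNReal.ofReal (√h ^ 3) * ENNReal.ofReal ((√‖y - c‖)⁻¹ ^ 3) ∂μ := by
        refine lintegral_mono_ae ((ae_restrict_of_ae hne).mono fun y hy => ?_)
        rw [← ENNReal.ofReal_mul (by positivity), ← mul_pow]
        exact ENNReal.ofReal_le_ofReal (pow_le_pow_left₀ (aspect_nonneg _ _ _)
          (aspect_le hh (by linarith) (norm_pos_iff.2 (sub_ne_zero.2 hy))) 3)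
    _ ≤ ENNReal.ofReal (√h ^ 3) * ENNReal.ofReal (2 ^ 4 * M * √R ^ (2 * k - 3)) := by
        rw [lintegral_const_mul' _ _ ENNReal.ofReal_ne_top]
        gcongr
        exact lintegral_inv_sqrt_norm_pow_le (by norm_num) hk hM hR hμ
    _ = _ := (ENNReal.ofReal_mul (by positivity)).symm

/-- The volume of the unit ball of `ℝ³`. -/
noncomputable def ballVolume : ℝ := (volume : Measure E3).real (Metric.ball 0 1)

lemma ballVolume_pos : 0 < ballVolume :=
  ENNReal.toReal_pos (Metric.measure_ball_pos volume 0 one_pos).ne' measure_ball_lt_top.ne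

lemma volume_closedBall (c : E3) {r : ℝ} (hr : 0 ≤ r) :
    volume (Metric.closedBall c r) = ENNReal.ofReal (ballVolume * r ^ 3) := by
  rw [Measure.addHaar_closedBall _ _ hr, ballVolume, ENNReal.ofReal_mul measureReal_nonneg,
    ofReal_measureReal measure_ball_lt_top.ne, mul_comm]
  simp

/-- The set of points that a small ball hides from `y` is small. -/
lemma exists_shadow (y c : E3) {h R : ℝ} (hh : 0 < h) (hR : 0 < R) :
    ∃ A : Set E3, MeasurableSet A ∧
      volume A ≤ ENNReal.ofReal (288 * ballVolume * R ^ 3 * aspect h c y ^ 4) ∧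
      ∀ z ∈ Metric.closedBall y R, (segment ℝ y z ∩ Metric.closedBall c h).Nonempty → z ∈ A := by
  have hκ := ballVolume_pos
  rw [aspect_pow_four hh]
  set d := ‖y - c‖ with hd
  have hd0 : 0 ≤ d := norm_nonneg _
  rcases le_or_gt d (2 * h) with hdh | hdh
  -- When `y` is close to the small ball, the weight is bounded below and all of the large ball may
  -- serve as shadow.
  · refine ⟨Metric.closedBall y R, measurableSet_closedBall, ?_, fun z hz _ => hz⟩
    rw [volume_closedBall _ hR.le]
    refine ENNReal.ofReal_le_ofReal ?_
    have h3 : 1 / 3 ≤ h / (h + d) := by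
      rw [div_le_div_iff₀ (by norm_num) (by positivity)]; linarith
    calc ballVolume * R ^ 3 ≤ 288 * ballVolume * R ^ 3 * (1 / 3) ^ 2 := by
          have : 0 ≤ ballVolume * R ^ 3 := by positivity
          nlinarith
      _ ≤ _ := by gcongr
  · have hdpos : 0 < d := by linarith
    -- The shadow lies in a cone about the ray from `y` through `c`. A hidden point is reached by
    -- dilating the small ball about `y` by at most 2R/d, so the cone has radius at most `ρ`. It is
    -- covered by balls of radius 2ρ centred on the axis at spacing `ρ`.
    set ρ := 2 * R * h / d with hρ
    have hρ0 : 0 < ρ := by positivity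
    have hρR : ρ ≤ R := by
      rw [hρ, div_le_iff₀ hdpos]; nlinarith
    set e := d⁻¹ • (c - y) with he
    have hnorm : ‖c - y‖ = d := by rw [hd, norm_sub_rev]
    have hen : ‖e‖ = 1 := by
      rw [he, norm_smul, hnorm, norm_inv, Real.norm_of_nonneg hd0, inv_mul_cancel₀ hdpos.ne']
    set N := ⌈2 * R / ρ⌉₊ with hN
    refine ⟨⋃ k ∈ Finset.range (N + 1), Metric.closedBall (y + ((k : ℝ) * ρ) • e) (2 * ρ),
      Finset.measurableSet_biUnion _ fun _ _ => measurableSet_closedBall, ?_, ?_⟩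
    · refine (measure_biUnion_finset_le _ _).trans ?_
      rw [Finset.sum_congr rfl fun k _ => volume_closedBall _ (by positivity : (0:ℝ) ≤ 2 * ρ),
        Finset.sum_const, Finset.card_range, ← ENNReal.ofReal_nsmul]
      refine ENNReal.ofReal_le_ofReal ?_
      rw [nsmul_eq_mul]
      have hN1 : ((N + 1 : ℕ) : ℝ) ≤ 4 * R / ρ := by
        have := Nat.ceil_lt_add_one (a := 2 * R / ρ) (by positivity)
        have h1 : 1 ≤ R / ρ := (one_le_div hρ0).2 hρR
        have h2 : 2 * R / ρ = 2 * (R / ρ) := by ring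
        have h4 : 4 * R / ρ = 4 * (R / ρ) := by ring
        push_cast
        rw [← hN, h2] at this
        linarith
      -- Here d > 2h gives h + d ≤ 3d/2; the constant arises as 288 · 4/9 = 128.
      have hq : (h / d) ^ 2 * (4 / 9) ≤ (h / (h + d)) ^ 2 := by
        have : h / d * (2 / 3) ≤ h / (h + d) := by
          rw [div_mul_div_comm, div_le_div_iff₀ (by positivity) (by positivity)]
          nlinarith
        calc (h / d) ^ 2 * (4 / 9) = (h / d * (2 / 3)) ^ 2 := by ring
          _ ≤ _ := pow_le_pow_left₀ (by positivity) this 2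
      calc ((N + 1 : ℕ) : ℝ) * (ballVolume * (2 * ρ) ^ 3)
          ≤ 4 * R / ρ * (ballVolume * (2 * ρ) ^ 3) := by gcongr
        _ = 288 * ballVolume * R ^ 3 * ((h / d) ^ 2 * (4 / 9)) := by
            rw [hρ]; field_simp; ring
        _ ≤ _ := by gcongr
    · rintro z hz ⟨w, hw, hwc⟩
      rw [segment_eq_image'] at hw
      obtain ⟨t, ⟨ht0, ht1⟩, rfl⟩ := hw
      rw [mem_closedBall_iff_norm] at hz hwc
      have hwy : d / 2 ≤ t * ‖z - y‖ := by
        have h1 : ‖c - y‖ ≤ ‖y + t • (z - y) - c‖ + ‖t • (z - y)‖ := by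
          rw [← norm_sub_rev c]
          calc ‖c - y‖ = ‖(c - (y + t • (z - y))) + t • (z - y)‖ := by congr 1; abel
            _ ≤ _ := norm_add_le _ _
        rw [norm_smul, Real.norm_of_nonneg ht0, hnorm] at h1
        linarith
      have htR : d / 2 ≤ t * R := hwy.trans (by gcongr)
      have ht : 0 < t := by
        by_contra hcon
        have : t = 0 := le_antisymm (not_lt.1 hcon) ht0
        rw [this, zero_mul] at htR
        linarith
      set s := t⁻¹ with hs
      have hs0 : 0 < s := by positivity
      have hsR : s ≤ 2 * R / d := by
        rw [hs, inv_eq_one_div, div_le_div_iff₀ ht hdpos]; linarith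
      have hsd : s * d ≤ 2 * R := by rwa [le_div_iff₀ hdpos] at hsR
      set k := ⌊s * d / ρ⌋₊ with hk
      have hk1 : (k : ℝ) ≤ s * d / ρ := Nat.floor_le (by positivity)
      have hk2 : s * d / ρ < k + 1 := Nat.lt_floor_add_one _
      rw [le_div_iff₀ hρ0] at hk1
      rw [div_lt_iff₀ hρ0] at hk2
      have hkN : k < N + 1 := by
        refine Nat.lt_succ_of_le (Nat.floor_le_of_le ?_)
        refine le_trans ?_ (Nat.le_ceil _)
        gcongr
      refine Set.mem_biUnion (Finset.mem_coe.2 (Finset.mem_range.2 hkN)) ?_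
      rw [mem_closedBall_iff_norm]
      -- The first term is the dilated offset from `c`, of norm at most `ρ`; the second is the error
      -- of rounding the axial position down to a multiple of `ρ`.
      have e1 : z - (y + ((k : ℝ) * ρ) • e)
          = s • (y + t • (z - y) - c) + (s * d - k * ρ) • e := by
        have hce : c - y = d • e := by
          rw [he, smul_smul, mul_inv_cancel₀ hdpos.ne', one_smul]
        have h1 : y + t • (z - y) - c = t • (z - y) - d • e := by rw [← hce]; abel
        have h2 : s • t • (z - y) = z - y := by
          rw [smul_smul, hs, inv_mul_cancel₀ ht.ne', one_smul]
        have h3 : (s * d) • e = s • d • e := mul_smul s d e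
        rw [h1, smul_sub, h2, sub_smul, h3]
        generalize s • d • e = v1
        generalize ((k : ℝ) * ρ) • e = v2
        abel
      rw [e1]
      calc ‖s • (y + t • (z - y) - c) + (s * d - k * ρ) • e‖
          ≤ s * ‖y + t • (z - y) - c‖ + |s * d - k * ρ| * 1 := by
            refine (norm_add_le _ _).trans ?_
            rw [norm_smul, norm_smul, hen, Real.norm_of_nonneg hs0.le, Real.norm_eq_abs]
        _ ≤ 2 * R / d * h + ρ * 1 := by
            gcongr
            rw [abs_of_nonneg (by linarith)]; linarith
        _ = 2 * ρ := by rw [hρ]; ring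

/-! ### Areas of faces and null sets. -/

/-- The area of the unit disc. -/
noncomputable def discArea : ℝ :=
  (volume : Measure (EuclideanSpace ℝ (Fin 2))).real (Metric.ball 0 1)

lemma discArea_pos : 0 < discArea :=
  ENNReal.toReal_pos (Metric.measure_ball_pos volume 0 one_pos).ne' measure_ball_lt_top.ne

/-- Hausdorff measure is invariant under isometries, so areas in the plane become Lebesgue measures
in ℝ². -/
lemma exists_isometry_plane {n : E3} (hn : ‖n‖ = 1) (q : E3) :
    ∃ f : EuclideanSpace ℝ (Fin 2) → E3, Isometry f ∧ Set.range f = {x | inner ℝ n (x - q) = 0} := by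
  have hn0 : n ≠ 0 := fun h => by simp [h] at hn
  have : Fact (Module.finrank ℝ E3 = 2 + 1) := ⟨by simp⟩
  have hfin : Module.finrank ℝ (Submodule.span ℝ {n})ᗮ = 2 :=
    Submodule.finrank_orthogonal_span_singleton hn0
  let L := ((stdOrthonormalBasis ℝ (Submodule.span ℝ {n})ᗮ).reindex (finCongr hfin)).repr.symm
  refine ⟨fun u => q + (L u : E3), ?_, ?_⟩
  · refine Isometry.of_dist_eq fun u v => ?_
    rw [dist_add_left, ← L.dist_map u v]
    rfl
  · ext x
    constructor
    · rintro ⟨u, rfl⟩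
      simpa using (Submodule.mem_orthogonal_singleton_iff_inner_right).1 (L u).2
    · intro hx
      refine ⟨L.symm ⟨x - q, Submodule.mem_orthogonal_singleton_iff_inner_right.2 hx⟩, ?_⟩
      simp

/-- The area of a disc. -/
lemma area_plane_inter_closedBall {n q a : E3} (hn : ‖n‖ = 1) (ha : inner ℝ n (a - q) = 0) {r : ℝ}
    (hr : 0 ≤ r) :
    (μHE[2] : Measure E3) (Metric.closedBall a r ∩ {x | inner ℝ n (x - q) = 0})
      = ENNReal.ofReal (discArea * r ^ 2) := by
  obtain ⟨f, hf, hfr⟩ := exists_isometry_plane hn q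
  obtain ⟨u, rfl⟩ : a ∈ Set.range f := hfr ▸ ha
  rw [← hfr, ← hf.euclideanHausdorffMeasure_preimage, hf.preimage_closedBall,
    EuclideanSpace.euclideanHausdorffMeasure_eq_volume, Measure.addHaar_closedBall _ _ hr, discArea,
    ENNReal.ofReal_mul measureReal_nonneg, ofReal_measureReal measure_ball_lt_top.ne, mul_comm]
  simp

/-- If the ball meets the plane at `a`, the section lies in the disc of radius 2r about `a`; hence
the factor 4. -/
lemma area_plane_inter_closedBall_le {n q : E3} (hn : ‖n‖ = 1) (c : E3) {r : ℝ} (hr : 0 ≤ r) :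
    (μHE[2] : Measure E3) (Metric.closedBall c r ∩ {x | inner ℝ n (x - q) = 0})
      ≤ ENNReal.ofReal (4 * discArea * r ^ 2) := by
  rcases (Metric.closedBall c r ∩ {x | inner ℝ n (x - q) = 0}).eq_empty_or_nonempty with h | ⟨a, ha⟩
  · rw [h]; simp
  · rw [show 4 * discArea * r ^ 2 = discArea * (2 * r) ^ 2 by ring,
      ← area_plane_inter_closedBall hn ha.2 (by positivity)]
    refine measure_mono (Set.inter_subset_inter_left _ ?_)
    refine Metric.closedBall_subset_closedBall' ?_
    have := Metric.mem_closedBall'.1 ha.1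
    linarith

/-- A segment has finite one-dimensional measure, so its two-dimensional measure cannot be infinite
and must vanish. -/
lemma area_edge {e : Finset E3} (he : e.card ≤ 2) : (μHE[2] : Measure E3) (simplex e) = 0 := by
  obtain ⟨a, b, hab⟩ : ∃ a b : E3, simplex e ⊆ segment ℝ a b := by
    interval_cases h : e.card
    · rw [Finset.card_eq_zero] at h
      exact ⟨0, 0, by simp [simplex, h]⟩
    · obtain ⟨a, rfl⟩ := Finset.card_eq_one.1 h
      exact ⟨a, a, by simp [simplex]⟩
    · obtain ⟨a, b, -, rfl⟩ := Finset.card_eq_two.1 h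
      exact ⟨a, b, by simp [simplex, convexHull_pair]⟩
  refine measure_mono_null hab ?_
  refine ((Measure.euclideanHausdorffMeasure_zero_or_top (X := E3) (d₁ := 1) (d₂ := 2)
    (by norm_num) _).resolve_right ?_)
  have h1 : (μH[((1 : ℕ) : ℝ)] : Measure E3) (segment ℝ a b) = edist a b := by
    rw [Nat.cast_one, hausdorffMeasure_segment]
  rw [Measure.euclideanHausdorffMeasure_def, Measure.smul_apply, h1, ENNReal.smul_def, smul_eq_mul]
  exact ENNReal.mul_ne_top ENNReal.coe_ne_top (edist_ne_top _ _)

lemma affineSpan_ne_top_of_card_le {e : Finset E3} (he : e.card ≤ 3) :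
    affineSpan ℝ (e : Set E3) ≠ ⊤ := by
  rcases e.eq_empty_or_nonempty with rfl | hne
  · simp
  intro htop
  have := hne.to_subtype
  have h1 := finrank_vectorSpan_range_add_one_le ℝ ((↑) : e → E3)
  rw [Subtype.range_coe_subtype, Finset.setOfPred_mem, ← direction_affineSpan, htop,
    AffineSubspace.direction_top, finrank_top, finrank_euclideanSpace, Fintype.card_fin,
    Fintype.card_coe] at h1
  omega

lemma volume_simplex_of_card_le {e : Finset E3} (he : e.card ≤ 3) : volume (simplex e) = 0 :=
  measure_mono_null (convexHull_subset_affineSpan _)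
    (Measure.addHaar_affineSubspace _ _ (affineSpan_ne_top_of_card_le he))

lemma interior_simplex_ae_eq (K : Finset E3) : interior (simplex K) =ᵐ[volume] simplex K :=
  interior_ae_eq_of_null_frontier ((convex_simplex K).addHaar_frontier volume)

namespace IsTet

variable {K : Finset E3}

lemma face_nonempty (h : IsTet K) {p : E3} (hp : p ∈ K) : (K.erase p).Nonempty := by
  rw [← Finset.card_pos, Finset.card_erase_of_mem hp, h.card]; norm_num

lemma exists_closedBall_subset (h : IsTet K) :
    ∃ c r, 0 < r ∧ Metric.closedBall c r ⊆ simplex K := by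
  obtain ⟨c, hc⟩ := h.interior_nonempty
  obtain ⟨r, hr, hcr⟩ := Metric.nhds_basis_closedBall.mem_iff.1 (mem_interior_iff_mem_nhds.1 hc)
  exact ⟨c, r, hr, hcr⟩

lemma face_subset_plane (h : IsTet K) {p q n : E3} (hp : p ∈ K) (hq : q ∈ K.erase p)
    (hn : IsUnitNormal (K.erase p) n) :
    simplex (K.erase p) ⊆ {x | inner ℝ n (x - q) = 0} := by
  intro x hx
  have := ((h.mem_face_iff (Finset.erase_subset p K)).1 hx).2 p hp (by simp)
  rw [Set.mem_ofPred_eq, h.inner_sub_eq hp hq hn, this, mul_zero]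

lemma area_face_inter_closedBall_le (h : IsTet K) {p : E3} (hp : p ∈ K) (c : E3) {r : ℝ}
    (hr : 0 ≤ r) :
    (μHE[2] : Measure E3) (Metric.closedBall c r ∩ simplex (K.erase p))
      ≤ ENNReal.ofReal (4 * discArea * r ^ 2) := by
  obtain ⟨q, hq⟩ := h.face_nonempty hp
  obtain ⟨n, hn⟩ := h.exists_unitNormal hp
  refine le_trans (measure_mono ?_) (area_plane_inter_closedBall_le (q := q) hn.1 c hr)
  exact Set.inter_subset_inter_right _ (h.face_subset_plane hp hq hn)

lemma area_face_lt_top (h : IsTet K) {p : E3} (hp : p ∈ K) :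
    (μHE[2] : Measure E3) (simplex (K.erase p)) < ⊤ := by
  obtain ⟨q, hq⟩ := h.face_nonempty hp
  refine lt_of_le_of_lt (measure_mono ?_) ((h.area_face_inter_closedBall_le hp q
    h.diam_pos.le).trans_lt ENNReal.ofReal_lt_top)
  refine Set.subset_inter (fun x hx => ?_) subset_rfl
  rw [mem_closedBall_iff_norm]
  have hs := simplex_mono (Finset.erase_subset p K)
  exact dist_le_simplexDiam (hs hx) (hs (subset_simplex hq))

lemma le_area_face (h : IsTet K) {p c : E3} (hp : p ∈ K) {r : ℝ} (hr : 0 < r)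
    (hb : Metric.closedBall c r ⊆ simplex K) :
    discArea * r ^ 2 ≤ (μHE[2] : Measure E3).real (simplex (K.erase p)) := by
  obtain ⟨a, ha, hdisc⟩ := h.exists_disc_subset_face hr hb hp
  obtain ⟨q, hq⟩ := h.face_nonempty hp
  obtain ⟨n, hn⟩ := h.exists_unitNormal hp
  have hpos := discArea_pos
  rw [measureReal_def, ← ENNReal.ofReal_le_iff_le_toReal (h.area_face_lt_top hp).ne,
    ← area_plane_inter_closedBall (q := q) (a := a) hn.1
      (by rw [h.inner_sub_eq hp hq hn, ha, mul_zero]) hr.le]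
  refine measure_mono fun x hx => hdisc x ?_ (mem_closedBall_iff_norm.1 hx.1)
  have := hx.2
  rw [Set.mem_ofPred_eq, h.inner_sub_eq hp hq hn] at this
  exact (mul_eq_zero.1 this).resolve_left (h.inner_ne_zero hp hq hn)

lemma area_face_pos (h : IsTet K) {p : E3} (hp : p ∈ K) :
    0 < (μHE[2] : Measure E3).real (simplex (K.erase p)) := by
  obtain ⟨c, r, hr, hb⟩ := h.exists_closedBall_subset
  have := discArea_pos
  exact lt_of_lt_of_le (by positivity) (h.le_area_face hp hr hb)

lemma eq_erase_of_subset (h : IsTet K) {F : Finset E3} (hF : F ⊆ K) (hc : F.card = 3) :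
    ∃ p ∈ K, F = K.erase p := by
  have h1 : (K \ F).card = 1 := by
    rw [Finset.card_sdiff_of_subset hF, h.card, hc]
  obtain ⟨p, hp⟩ := Finset.card_eq_one.1 h1
  have hpK : p ∈ K \ F := by rw [hp]; simp
  refine ⟨p, (Finset.mem_sdiff.1 hpK).1, ?_⟩
  rw [← Finset.sdiff_singleton_eq_erase, ← hp, Finset.sdiff_sdiff_eq_self hF]

lemma volume_interior_pos (h : IsTet K) : 0 < volume (interior (simplex K)) :=
  isOpen_interior.measure_pos volume h.interior_nonempty

/-- The trace on the boundary of a function that is affine near the boundary point. -/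
lemma traceFrom_eq (h : IsTet K) {U : Set E3} {u p : E3 → E3} (hp : Continuous p)
    (hu : Set.EqOn u p U) {y : E3} (hy : y ∈ simplex K)
    (hU : ∀ᶠ x in nhdsWithin y (interior (simplex K)), x ∈ U) : traceFrom K u y = p y := by
  refine extendFrom_eq (by rwa [h.closure_interior]) ?_
  refine (hp.continuousAt.mono_left nhdsWithin_le_nhds).congr' ?_
  filter_upwards [hU] with x hx using (hu hx).symm

lemma traceFrom_eq_self (h : IsTet K) {u p : E3 → E3} (hp : Continuous p)
    (hu : Set.EqOn u p (interior (simplex K))) {y : E3} (hy : y ∈ simplex K) :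
    traceFrom K u y = p y :=
  h.traceFrom_eq hp hu hy self_mem_nhdsWithin

end IsTet

/-! ### Triangulations, refinements and coarse faces. -/

namespace Triangulation

variable {Ω : Set E3} {T TH Th : Triangulation Ω} {K K₁ K₂ F : Finset E3}

lemma mem_cells : K ∈ T.cells ↔ K ∈ T.complex.faces ∧ K.card = 4 := by
  simp [cells]

lemma mem_triangles : K ∈ T.triangles ↔ K ∈ T.complex.faces ∧ K.card = 3 := by
  simp [triangles]

lemma isTet (hK : K ∈ T.cells) : IsTet K :=
  ⟨(mem_cells.1 hK).2, T.complex.indep (mem_cells.1 hK).1⟩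

lemma mem_simplex_inter {s t : Finset E3} (hs : s ∈ T.complex.faces) (ht : t ∈ T.complex.faces)
    {x : E3} (hxs : x ∈ simplex s) (hxt : x ∈ simplex t) : x ∈ simplex (s ∩ t) := by
  have := T.complex.inter_subset_convexHull hs ht ⟨hxs, hxt⟩
  rwa [simplex, Finset.coe_inter]

lemma card_inter_lt {n : ℕ} (h₁ : K₁.card = n) (h₂ : K₂.card = n) (h : K₁ ≠ K₂) :
    (K₁ ∩ K₂).card < n := by
  by_contra hlt
  have e1 := Finset.eq_of_subset_of_card_le (Finset.inter_subset_left (s₁ := K₁) (s₂ := K₂))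
    (by omega)
  have e2 := Finset.eq_of_subset_of_card_le (Finset.inter_subset_right (s₁ := K₁) (s₂ := K₂))
    (by omega)
  exact h (e1.symm.trans e2)

/-- An overlap would be open and contained in the common face, which has at most three vertices and
zero volume. -/
lemma disjoint_interior (h₁ : K₁ ∈ T.cells) (h₂ : K₂ ∈ T.cells) (h : K₁ ≠ K₂) :
    Disjoint (interior (simplex K₁)) (interior (simplex K₂)) := by
  rw [Set.disjoint_iff_inter_eq_empty,
    ← (isOpen_interior.inter isOpen_interior).measure_eq_zero_iff volume]
  refine measure_mono_null ?_ (volume_simplex_of_card_le (Nat.lt_succ_iff.1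
    (card_inter_lt (isTet h₁).card (isTet h₂).card h)))
  exact fun x hx => mem_simplex_inter (mem_cells.1 h₁).1 (mem_cells.1 h₂).1
    (interior_subset hx.1) (interior_subset hx.2)

lemma face_mem_triangles (hK : K ∈ T.cells) {p : E3} (hp : p ∈ K) : K.erase p ∈ T.triangles :=
  mem_triangles.2 ⟨T.complex.down_closed (mem_cells.1 hK).1 (Finset.erase_subset _ _)
    ((isTet hK).face_nonempty hp), by rw [Finset.card_erase_of_mem hp, (isTet hK).card]⟩

lemma exists_cell_of_triangle (hF : F ∈ T.triangles) : ∃ K ∈ T.cells, ∃ p ∈ K, F = K.erase p := by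
  obtain ⟨K, hK, hFK, hc⟩ := T.pure F (mem_triangles.1 hF).1
  have hK' : K ∈ T.cells := mem_cells.2 ⟨hK, hc⟩
  exact ⟨K, hK', (isTet hK').eq_erase_of_subset hFK (mem_triangles.1 hF).2⟩

lemma exists_erase_eq (hK : K ∈ T.cells) (hF : F ∈ T.triangles) (h : F ⊆ K) :
    ∃ p ∈ K, F = K.erase p :=
  (isTet hK).eq_erase_of_subset h (mem_triangles.1 hF).2

lemma interior_simplex_subset (hK : K ∈ T.cells) : interior (simplex K) ⊆ Ω := by
  rw [← T.interior_space]
  exact interior_mono (T.complex.convexHull_subset_space (mem_cells.1 hK).1)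

lemma exists_cell_of_mem {x : E3} (hx : x ∈ Ω) : ∃ K ∈ T.cells, x ∈ simplex K := by
  rw [← T.interior_space] at hx
  obtain ⟨s, hs, hxs⟩ := T.complex.mem_space_iff.1 (interior_subset hx)
  obtain ⟨K, hK, hsK, hc⟩ := T.pure s hs
  exact ⟨K, mem_cells.2 ⟨hK, hc⟩, simplex_mono hsK hxs⟩

open Classical in
/-- The tetrahedra of a triangulation that are contained in a given one. -/
noncomputable def cellsIn (T : Triangulation Ω) (K : Finset E3) : Finset (Finset E3) :=
  T.cells.filter fun A => simplex A ⊆ simplex K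

lemma mem_cellsIn {A : Finset E3} :
    A ∈ T.cellsIn K ↔ A ∈ T.cells ∧ simplex A ⊆ simplex K := by
  simp [cellsIn]

/-- By closedness it suffices to cover interior points of `K`. A fine cell through such a point lies
in some coarse cell; were that not `K`, its interior would meet that of `K` near the point. -/
lemma exists_mem_cellsIn (href : Th.IsRefinement TH) (hK : K ∈ TH.cells) {x : E3}
    (hx : x ∈ simplex K) : ∃ A ∈ Th.cellsIn K, x ∈ simplex A := by
  have hcl : IsClosed (⋃ A ∈ Th.cellsIn K, simplex A) :=
    (Th.cellsIn K).finite_toSet.isClosed_biUnion fun A _ => isClosed_simplex A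
  suffices h : simplex K ⊆ ⋃ A ∈ Th.cellsIn K, simplex A by simpa using h hx
  rw [← (isTet hK).closure_interior]
  refine closure_minimal (fun y hy => ?_) hcl
  obtain ⟨A, hA, hyA⟩ := Th.exists_cell_of_mem (interior_simplex_subset hK hy)
  obtain ⟨K', hK', hAK'⟩ := href A hA
  have hKK' : K = K' := by
    by_contra hne
    have h1 : y ∈ closure (interior (simplex K')) := by
      rw [(isTet hK').closure_interior]; exact hAK' hyA
    obtain ⟨z, hz1, hz2⟩ := mem_closure_iff.1 h1 _ isOpen_interior hy
    exact Set.disjoint_left.1 (disjoint_interior hK hK' hne) hz1 hz2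
  subst hKK'
  exact Set.mem_biUnion (mem_cellsIn.2 ⟨hA, hAK'⟩) hyA

/-- The union of the edges and vertices of a triangulation. -/
def edgeSet (T : Triangulation Ω) : Set E3 :=
  ⋃ e ∈ T.finite_faces.toFinset.filter fun s => s.card ≤ 2, simplex e

lemma mem_edgeSet {e : Finset E3} (he : e ∈ T.complex.faces) (hc : e.card ≤ 2) {x : E3}
    (hx : x ∈ simplex e) : x ∈ T.edgeSet :=
  Set.mem_biUnion (by simpa using ⟨he, hc⟩) hx

lemma area_edgeSet (T : Triangulation Ω) : (μHE[2] : Measure E3) T.edgeSet = 0 := by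
  refine (measure_biUnion_null_iff (Finset.countable_toSet _)).2 fun e he => area_edge ?_
  exact (Finset.mem_filter.1 he).2

/-- From a point off the edges, almost every point is seen without an edge in between. -/
lemma ae_segment_disjoint_edgeSet (T : Triangulation Ω) {y : E3} (hy : y ∉ T.edgeSet) :
    ∀ᵐ z : E3, ∀ x ∈ segment ℝ y z, x ∉ T.edgeSet := by
  -- If the segment meets an edge at x ≠ y, then `z` lies on the line through `y` and x, hence in
  -- the affine span of `y` and the edge, which is at most a plane.
  have hnull : volume (⋃ e ∈ T.finite_faces.toFinset.filter fun s => s.card ≤ 2,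
      (affineSpan ℝ ((insert y e : Finset E3) : Set E3) : Set E3)) = 0 := by
    refine (measure_biUnion_null_iff (Finset.countable_toSet _)).2 fun e he => ?_
    refine Measure.addHaar_affineSubspace _ _ (affineSpan_ne_top_of_card_le ?_)
    have := (Finset.mem_filter.1 he).2
    exact (Finset.card_insert_le _ _).trans (by omega)
  filter_upwards [measure_eq_zero_iff_ae_notMem.1 hnull] with z hz x hx hxe
  obtain ⟨e, he, hxe'⟩ := Set.mem_iUnion₂.1 hxe
  refine hz (Set.mem_biUnion he ?_)
  rw [segment_eq_image_lineMap] at hx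
  obtain ⟨t, -, rfl⟩ := hx
  have ht : t ≠ 0 := by
    rintro rfl
    rw [AffineMap.lineMap_apply_zero] at hxe
    exact hy hxe
  have hz' : z = AffineMap.lineMap y (AffineMap.lineMap y z t) t⁻¹ := by
    simp [AffineMap.lineMap_apply, smul_smul, inv_mul_cancel₀ ht]
  rw [hz']
  refine AffineMap.lineMap_mem _ (subset_affineSpan ℝ _ (by simp)) ?_
  exact affineSpan_mono ℝ (by simp) (convexHull_subset_affineSpan _ hxe')

/-- Near a point of a coarse face that is on no edge of the refinement, the coarse tetrahedron
coincides with a fine one. -/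
lemma exists_fine_face (hK : K ∈ TH.cells) {P : E3} (hP : P ∈ K) {A : Finset E3}
    (hA : A ∈ Th.cellsIn K) {y : E3} (hyF : y ∈ simplex (K.erase P)) (hyA : y ∈ simplex A)
    (hye : y ∉ Th.edgeSet) :
    ∃ a ∈ A, y ∈ simplex (A.erase a) ∧ (∀ b ∈ A.erase a, ∀ G ⊆ A, y ∈ simplex G → b ∈ G) ∧
      simplex (A.erase a) ⊆ simplex (K.erase P) ∧
      ∀ᶠ x in nhdsWithin y (interior (simplex K)), x ∈ interior (simplex A) := by
  obtain ⟨hAc, hAK⟩ := mem_cellsIn.1 hA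
  have hTK := isTet hK
  have hTA := isTet hAc
  set f := hTK.bary P with hf
  have hfF : ∀ x, x ∈ simplex (K.erase P) ↔ x ∈ simplex K ∧ f x = 0 := by
    intro x
    rw [hTK.mem_face_iff (Finset.erase_subset _ _)]
    refine and_congr_right fun _ => ⟨fun h => h P hP (by simp), fun h p hp hpe => ?_⟩
    have : p = P := by
      by_contra hne
      exact hpe (Finset.mem_erase.2 ⟨hne, hp⟩)
    rw [this]; exact h
  have hfA : ∀ b ∈ A, 0 ≤ f b := fun b hb =>
    hTK.mem_simplex_iff.1 (hAK (subset_simplex hb)) P hP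
  have hyA' := hTA.mem_simplex_iff.1 hyA
  have hexp : ∀ x, f x = ∑ b ∈ A, hTA.bary b x * f b := fun x => hTA.map_eq_sum f x
  -- The coordinate `f` is nonnegative at the vertices of `A` and zero at `y`, so every term of its
  -- barycentric expansion at `y` vanishes.
  have hzero : ∀ b ∈ A, hTA.bary b y * f b = 0 := by
    refine (Finset.sum_eq_zero_iff_of_nonneg fun b hb => mul_nonneg (hyA' b hb) (hfA b hb)).1 ?_
    rw [← hexp, ((hfF y).1 hyF).2]
  classical
  -- The smallest face of `A` containing `y`. It has at least three vertices because `y` is on no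
  -- edge, and at most three because `f` vanishes on it but not identically.
  set Z := A.filter fun b => hTA.bary b y ≠ 0 with hZ
  have hZA : Z ⊆ A := Finset.filter_subset _ _
  have hyZ : y ∈ simplex Z := by
    rw [hTA.mem_face_iff hZA]
    refine ⟨hyA, fun b hb hbZ => ?_⟩
    by_contra hne
    exact hbZ (Finset.mem_filter.2 ⟨hb, hne⟩)
  have hZne : Z.Nonempty := by
    rw [Finset.nonempty_iff_ne_empty]
    intro h0
    rw [h0] at hyZ
    simp [simplex] at hyZ
  have hZ3 : 3 ≤ Z.card := by
    by_contra hlt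
    exact hye (mem_edgeSet (Th.complex.down_closed (mem_cells.1 hAc).1 hZA hZne) (by omega) hyZ)
  have hfZ : ∀ b ∈ Z, f b = 0 := fun b hb =>
    (mul_eq_zero.1 (hzero b (hZA hb))).resolve_left (Finset.mem_filter.1 hb).2
  have hZlt : Z.card < 4 := by
    by_contra hge
    have hZA' : Z = A := Finset.eq_of_subset_of_card_le hZA (by rw [hTA.card]; omega)
    have h1 : f P = 1 := hTK.bary_self hP
    rw [hexp, Finset.sum_eq_zero fun b hb => by rw [hfZ b (hZA' ▸ hb), mul_zero]] at h1
    norm_num at h1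
  obtain ⟨a, ha, hZe⟩ := hTA.eq_erase_of_subset hZA (by omega)
  have hfx : ∀ x, f x = hTA.bary a x * f a := by
    intro x
    rw [hexp, Finset.sum_eq_single_of_mem a ha]
    intro b hb hba
    rw [hfZ b (by rw [hZe]; exact Finset.mem_erase.2 ⟨hba, hb⟩), mul_zero]
  have hpos : ∀ b ∈ A.erase a, 0 < hTA.bary b y := fun b hb => by
    rw [← hZe] at hb
    exact lt_of_le_of_ne (hyA' b (hZA hb)) (Ne.symm (Finset.mem_filter.1 hb).2)
  refine ⟨a, ha, hZe ▸ hyZ, fun b hb G hGA hyG => ?_, fun x hx => ?_, ?_⟩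
  · by_contra hbG
    exact (hpos b hb).ne' (((hTA.mem_face_iff hGA).1 hyG).2 b (Finset.mem_of_mem_erase hb) hbG)
  · rw [hfF]
    have hx' := (hTA.mem_face_iff (Finset.erase_subset _ _)).1 hx
    exact ⟨hAK hx'.1, by rw [hfx, hx'.2 a ha (by simp), zero_mul]⟩
  -- Near `y` three coordinates stay positive by continuity; the fourth is positive inside `K`
  -- because `f` is a multiple of it.
  · have hev : ∀ᶠ x in nhds y, ∀ b ∈ A.erase a, 0 < hTA.bary b x := by
      rw [Filter.eventually_all_finset]
      intro b hb
      exact (hTA.continuous_bary b).continuousAt.eventually (lt_mem_nhds (hpos b hb))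
    filter_upwards [nhdsWithin_le_nhds hev, self_mem_nhdsWithin] with x hx hxK
    rw [hTA.mem_interior_iff]
    intro b hb
    by_cases hba : b = a
    · have h1 := hTK.mem_interior_iff.1 hxK P hP
      rw [← hf, hfx] at h1
      rw [hba]
      exact lt_of_not_ge fun h => h1.not_ge (mul_nonpos_of_nonpos_of_nonneg h (hfA a ha))
    · exact hx b (Finset.mem_erase.2 ⟨hba, hb⟩)

/-- Two fine tetrahedra on both sides of a coarse face share a triangle. -/
lemma fine_face_eq (h₁ : K₁ ∈ TH.cells) (h₂ : K₂ ∈ TH.cells) (hne : K₁ ≠ K₂)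
    {A₁ A₂ : Finset E3} (hA₁ : A₁ ∈ Th.cellsIn K₁) (hA₂ : A₂ ∈ Th.cellsIn K₂) {a₁ a₂ y : E3}
    (ha₁ : a₁ ∈ A₁) (ha₂ : a₂ ∈ A₂) (hy₁ : y ∈ simplex A₁) (hy₂ : y ∈ simplex A₂)
    (hm₁ : ∀ b ∈ A₁.erase a₁, ∀ G ⊆ A₁, y ∈ simplex G → b ∈ G)
    (hm₂ : ∀ b ∈ A₂.erase a₂, ∀ G ⊆ A₂, y ∈ simplex G → b ∈ G) :
    A₁ ≠ A₂ ∧ A₁.erase a₁ = A₂.erase a₂ := by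
  obtain ⟨hc₁, hs₁⟩ := mem_cellsIn.1 hA₁
  obtain ⟨hc₂, hs₂⟩ := mem_cellsIn.1 hA₂
  have hA : A₁ ≠ A₂ := by
    rintro rfl
    obtain ⟨x, hx⟩ := (isTet hc₁).interior_nonempty
    exact Set.disjoint_left.1 (disjoint_interior h₁ h₂ hne) (interior_mono hs₁ hx)
      (interior_mono hs₂ hx)
  have hyi := mem_simplex_inter (mem_cells.1 hc₁).1 (mem_cells.1 hc₂).1 hy₁ hy₂
  have hlt := card_inter_lt (isTet hc₁).card (isTet hc₂).card hA
  -- By minimality the face is contained in the common face of the two cells, which has at most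
  -- three vertices.
  have e1 : A₁.erase a₁ = A₁ ∩ A₂ := Finset.eq_of_subset_of_card_le
    (fun b hb => hm₁ b hb _ Finset.inter_subset_left hyi)
    (by rw [Finset.card_erase_of_mem ha₁, (isTet hc₁).card]; omega)
  have e2 : A₂.erase a₂ = A₁ ∩ A₂ := Finset.eq_of_subset_of_card_le
    (fun b hb => hm₂ b hb _ Finset.inter_subset_right hyi)
    (by rw [Finset.card_erase_of_mem ha₂, (isTet hc₂).card]; omega)
  exact ⟨hA, e1.trans e2.symm⟩

open Classical in
/-- The triangles of a triangulation that are contained in a given one. -/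
noncomputable def trianglesIn (T : Triangulation Ω) (F : Finset E3) : Finset (Finset E3) :=
  T.triangles.filter fun G => simplex G ⊆ simplex F

lemma mem_trianglesIn {G : Finset E3} :
    G ∈ T.trianglesIn F ↔ G ∈ T.triangles ∧ simplex G ⊆ simplex F := by
  simp [trianglesIn]

lemma aedisjoint_triangles {G₁ G₂ : Finset E3} (h₁ : G₁ ∈ T.triangles) (h₂ : G₂ ∈ T.triangles)
    (h : G₁ ≠ G₂) : AEDisjoint (μHE[2] : Measure E3) (simplex G₁) (simplex G₂) := by
  refine measure_mono_null (t := simplex (G₁ ∩ G₂)) (fun x hx => ?_) (area_edge ?_)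
  · exact mem_simplex_inter (mem_triangles.1 h₁).1 (mem_triangles.1 h₂).1 hx.1 hx.2
  · exact Nat.lt_succ_iff.1 (card_inter_lt (mem_triangles.1 h₁).2 (mem_triangles.1 h₂).2 h)

/-- Each coarse face is the union of fine triangles. -/
lemma face_ae_eq (href : Th.IsRefinement TH) (hK : K ∈ TH.cells) {P : E3} (hP : P ∈ K) :
    simplex (K.erase P) =ᵐ[(μHE[2] : Measure E3)]
      ⋃ G : Th.trianglesIn (K.erase P), simplex (G : Finset E3) := by
  have hsub : (⋃ G : Th.trianglesIn (K.erase P), simplex (G : Finset E3)) ⊆ simplex (K.erase P) :=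
    Set.iUnion_subset fun G => (mem_trianglesIn.1 G.2).2
  refine (ae_le_set.2 (measure_mono_null (fun y hy => ?_) Th.area_edgeSet)).antisymm
    hsub.eventuallyLE
  by_contra hye
  obtain ⟨A, hA, hyA⟩ := exists_mem_cellsIn href hK (simplex_mono (Finset.erase_subset _ _) hy.1)
  obtain ⟨a, ha, hya, -, hs, -⟩ := exists_fine_face hK hP hA hy.1 hyA hye
  exact hy.2 (Set.mem_iUnion.2 ⟨⟨A.erase a, mem_trianglesIn.2
    ⟨face_mem_triangles (mem_cellsIn.1 hA).1 ha, hs⟩⟩, hya⟩)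

/-- Each fine triangle in a coarse face belongs to a fine tetrahedron on the given side. -/
lemma exists_cell_of_trianglesIn (href : Th.IsRefinement TH) (hK : K ∈ TH.cells) {P : E3}
    (hP : P ∈ K) {G : Finset E3} (hG : G ∈ Th.trianglesIn (K.erase P)) :
    ∃ A ∈ Th.cellsIn K, ∃ a ∈ A, G = A.erase a ∧ ∃ y ∈ simplex G, y ∉ Th.edgeSet ∧
      ∀ b ∈ A.erase a, ∀ G ⊆ A, y ∈ simplex G → b ∈ G := by
  obtain ⟨hGt, hGs⟩ := mem_trianglesIn.1 hG
  obtain ⟨A₀, hA₀, a₀, ha₀, rfl⟩ := exists_cell_of_triangle hGt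
  -- The triangle has positive area and the edges have none.
  obtain ⟨y, hyG, hye⟩ : ∃ y ∈ simplex (A₀.erase a₀), y ∉ Th.edgeSet := by
    by_contra! hcon
    have := (isTet hA₀).area_face_pos ha₀
    rw [measureReal_def, measure_mono_null hcon Th.area_edgeSet] at this
    simp at this
  obtain ⟨A, hA, hyA⟩ := exists_mem_cellsIn href hK
    (simplex_mono (Finset.erase_subset _ _) (hGs hyG))
  obtain ⟨a, ha, hya, hm, hs, -⟩ := exists_fine_face hK hP hA (hGs hyG) hyA hye
  refine ⟨A, hA, a, ha, ?_, y, hyG, hye, hm⟩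
  -- Two distinct triangles share at most an edge, but both contain `y`.
  by_contra hne
  have hAt := face_mem_triangles (mem_cellsIn.1 hA).1 ha
  have hyi := mem_simplex_inter (mem_triangles.1 hGt).1 (mem_triangles.1 hAt).1 hyG hya
  have hlt := card_inter_lt (mem_triangles.1 hGt).2 (mem_triangles.1 hAt).2 hne
  refine hye (mem_edgeSet (Th.complex.down_closed (mem_triangles.1 hGt).1
    Finset.inter_subset_left ?_) (Nat.lt_succ_iff.1 hlt) hyi)
  rw [Finset.nonempty_iff_ne_empty]
  intro h0
  rw [h0] at hyi
  simp [simplex] at hyi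

/-- A function on a coarse face whose integrals over the fine triangles vanish has zero mean. -/
lemma setIntegral_face_eq_zero (href : Th.IsRefinement TH) (hK : K ∈ TH.cells) {P : E3}
    (hP : P ∈ K) {D : E3 → E3}
    (hint : ∀ G ∈ Th.trianglesIn (K.erase P), IntegrableOn D (simplex G) μHE[2])
    (hz : ∀ G ∈ Th.trianglesIn (K.erase P), ∫ x in simplex G, D x ∂μHE[2] = 0) :
    ∫ x in simplex (K.erase P), D x ∂μHE[2] = 0 := by
  have hae := face_ae_eq href hK hP
  have hint' : IntegrableOn D (⋃ G : Th.trianglesIn (K.erase P), simplex (G : Finset E3)) μHE[2] :=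
    integrableOn_finite_iUnion.2 fun G => hint G G.2
  rw [setIntegral_congr_set hae, integral_iUnion_ae
    (fun G => (measurableSet_simplex _).nullMeasurableSet) ?_ hint']
  · simp [hz]
  · intro G₁ G₂ hne
    exact aedisjoint_triangles (mem_trianglesIn.1 G₁.2).1 (mem_trianglesIn.1 G₂.2).1
      fun h => hne (Subtype.ext h)

lemma integrableOn_face (href : Th.IsRefinement TH) (hK : K ∈ TH.cells) {P : E3}
    (hP : P ∈ K) {D : E3 → E3}
    (hint : ∀ G ∈ Th.trianglesIn (K.erase P), IntegrableOn D (simplex G) μHE[2]) :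
    IntegrableOn D (simplex (K.erase P)) μHE[2] :=
  (integrableOn_finite_iUnion.2 fun G : Th.trianglesIn (K.erase P) => hint G G.2).congr_set_ae
    (face_ae_eq href hK hP)

end Triangulation

/-! ### Crouzeix–Raviart functions along segments, and the pointwise bound by the potential. -/

/-- If finitely many closed sets cover a preconnected set, then the values attached to any two of
them differ by at most twice the sum of weights that control the differences of the values
attached to intersecting sets. -/
lemma norm_sub_le_sum_of_isPreconnected {ι X E : Type*} [Fintype ι] [TopologicalSpace X]
    [SeminormedAddCommGroup E] {S : Set X} (hS : IsPreconnected S) {I : ι → Set X}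
    (hI : ∀ i, IsClosed (I i)) (hne : ∀ i, (S ∩ I i).Nonempty) (hcov : S ⊆ ⋃ i, I i)
    {v : ι → E} {w : ι → ℝ} (hw : ∀ i, 0 ≤ w i)
    (hvw : ∀ i j, i ≠ j → (S ∩ (I i ∩ I j)).Nonempty → ‖v i - v j‖ ≤ w i + w j) (i j : ι) :
    ‖v i - v j‖ ≤ 2 * ∑ k, w k := by
  classical
  let G : SimpleGraph ι :=
    { Adj := fun i j => i ≠ j ∧ (S ∩ (I i ∩ I j)).Nonempty
      symm := ⟨fun i j h => ⟨h.1.symm, by rw [Set.inter_comm (I j)]; exact h.2⟩⟩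
      loopless := ⟨fun i h => h.1 rfl⟩ }
  -- Otherwise the sets reachable from `i` and the remaining ones form two closed families that
  -- cover `S` without meeting inside it.
  have hreach : G.Reachable i j := by
    by_contra hij
    have hU : IsClosed (⋃ k ∈ {k | G.Reachable i k}, I k) :=
      (Set.toFinite _).isClosed_biUnion fun k _ => hI k
    have hV : IsClosed (⋃ k ∈ {k | ¬ G.Reachable i k}, I k) :=
      (Set.toFinite _).isClosed_biUnion fun k _ => hI k
    obtain ⟨x, hxS, hxU, hxV⟩ := isPreconnected_closed_iff.1 hS _ _ hU hV (fun x hx => by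
        obtain ⟨k, hk⟩ := Set.mem_iUnion.1 (hcov hx)
        by_cases hik : G.Reachable i k
        · exact Or.inl (Set.mem_biUnion hik hk)
        · exact Or.inr (Set.mem_biUnion hik hk))
      ((hne i).mono (Set.inter_subset_inter_right _
        (Set.subset_biUnion_of_mem (u := I) (SimpleGraph.Reachable.refl i))))
      ((hne j).mono (Set.inter_subset_inter_right _
        (Set.subset_biUnion_of_mem (u := I) (x := j) hij)))
    obtain ⟨k, hk, hxk⟩ := Set.mem_iUnion₂.1 hxU
    obtain ⟨l, hl, hxl⟩ := Set.mem_iUnion₂.1 hxV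
    refine hl (SimpleGraph.Reachable.trans hk (SimpleGraph.Adj.reachable ⟨?_, x, hxS, hxk, hxl⟩))
    rintro rfl
    exact hl hk
  -- The summand `w a` closes the induction: each vertex is charged once for entering and once for
  -- leaving.
  have hwalk : ∀ {a b : ι} (p : G.Walk a b),
      ‖v a - v b‖ + w a ≤ 2 * (p.support.map w).sum := by
    intro a b p
    induction p with
    | nil => simp only [sub_self, norm_zero, SimpleGraph.Walk.support_nil, List.map_cons,
        List.map_nil, List.sum_cons, List.sum_nil]; linarith [hw ‹ι›]
    | @cons a b c hab p ih =>
      rw [SimpleGraph.Walk.support_cons, List.map_cons, List.sum_cons]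
      have h1 := hvw a b hab.1 hab.2
      have h2 := norm_sub_le_norm_sub_add_norm_sub (v a) (v b) (v c)
      linarith
  -- A path visits no vertex twice, so its weights sum to at most the total weight.
  obtain ⟨p, hp⟩ := hreach.exists_isPath
  have h1 := hwalk p
  have h2 : (p.support.map w).sum ≤ ∑ k, w k := by
    rw [← List.sum_toFinset _ hp.support_nodup]
    exact Finset.sum_le_sum_of_subset_of_nonneg (Finset.subset_univ _) fun k _ _ => hw k
  linarith [hw i]

/-- The Frobenius norm of the gradient of an affine map. -/
noncomputable def gradNorm (p : E3 →ᵃ[ℝ] E3) : ℝ :=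
  √(∑ i : Fin 3, ‖p.linear (EuclideanSpace.single i 1)‖ ^ 2)

lemma gradNorm_nonneg (p : E3 →ᵃ[ℝ] E3) : 0 ≤ gradNorm p := Real.sqrt_nonneg _

/-- Cauchy–Schwarz over the coordinates: the operator norm is at most the Frobenius norm. -/
lemma norm_sub_le_gradNorm (p : E3 →ᵃ[ℝ] E3) (x y : E3) : ‖p x - p y‖ ≤ gradNorm p * ‖x - y‖ := by
  have h1 : p x - p y = p.linear (x - y) := (p.linearMap_vsub x y).symm
  rw [h1]
  set u := x - y
  have h2 : u = ∑ i : Fin 3, u i • EuclideanSpace.single i (1 : ℝ) := by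
    conv_lhs => rw [← (EuclideanSpace.basisFun (Fin 3) ℝ).sum_repr u]
    simp
  have h3 : ‖u‖ = √(∑ i : Fin 3, |u i| ^ 2) := by
    rw [EuclideanSpace.norm_eq]; simp
  conv_lhs => rw [h2, map_sum]
  refine (norm_sum_le _ _).trans ?_
  rw [h3, mul_comm, gradNorm]
  simp only [map_smul, norm_smul, Real.norm_eq_abs]
  exact Real.sum_mul_le_sqrt_mul_sqrt _ _ _

lemma AffineMap.continuous_E3 (p : E3 →ᵃ[ℝ] E3) : Continuous p := p.continuous_of_finiteDimensional

open Classical in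
/-- A vertex of a simplex. -/
noncomputable def someVertex (A : Finset E3) : E3 := if h : A.Nonempty then h.choose else 0

lemma someVertex_mem {A : Finset E3} (h : A.Nonempty) : someVertex A ∈ A := by
  rw [someVertex, dif_pos h]; exact h.choose_spec

lemma IsTet.nonempty {A : Finset E3} (h : IsTet A) : A.Nonempty := by
  rw [← Finset.card_pos, h.card]; norm_num

lemma simplexDiam_mono {A B : Finset E3} (h : simplex A ⊆ simplex B) :
    simplexDiam A ≤ simplexDiam B :=
  Metric.diam_mono h (isCompact_simplex B).isBounded

namespace Triangulation.IsCrouzeixRaviart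

variable {Ω : Set E3} {TH Th : Triangulation Ω} {ψ : E3 → E3} {K A B F : Finset E3}

open Classical in
/-- The affine map that coincides with a Crouzeix–Raviart function on a tetrahedron. -/
noncomputable def piece (hψ : Th.IsCrouzeixRaviart ψ) (A : Finset E3) : E3 →ᵃ[ℝ] E3 :=
  if h : A ∈ Th.cells then (hψ.affine A h).choose else 0

lemma eqOn_piece (hψ : Th.IsCrouzeixRaviart ψ) (hA : A ∈ Th.cells) :
    Set.EqOn ψ (hψ.piece A) (interior (simplex A)) := by
  rw [piece, dif_pos hA]; exact (hψ.affine A hA).choose_spec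

lemma traceFrom_eq_piece (hψ : Th.IsCrouzeixRaviart ψ) (hA : A ∈ Th.cells) {x : E3}
    (hx : x ∈ simplex A) : traceFrom A ψ x = hψ.piece A x :=
  (isTet hA).traceFrom_eq_self (hψ.piece A).continuous_E3 (hψ.eqOn_piece hA) hx

/-- The size of the gradient of a Crouzeix–Raviart function on a tetrahedron. -/
noncomputable def grad (hψ : Th.IsCrouzeixRaviart ψ) (A : Finset E3) : ℝ := gradNorm (hψ.piece A)

lemma grad_nonneg (hψ : Th.IsCrouzeixRaviart ψ) (A : Finset E3) : 0 ≤ hψ.grad A :=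
  gradNorm_nonneg _

lemma norm_piece_sub_le (hψ : Th.IsCrouzeixRaviart ψ) {x y : E3} {d : ℝ} (h : ‖x - y‖ ≤ d) :
    ‖hψ.piece A x - hψ.piece A y‖ ≤ hψ.grad A * d :=
  (norm_sub_le_gradNorm _ x y).trans (mul_le_mul_of_nonneg_left h (hψ.grad_nonneg A))

lemma brokenSeminormSq_eq (hψ : Th.IsCrouzeixRaviart ψ) :
    Th.brokenSeminormSq ψ = ∑ A ∈ Th.cells, volume.real (simplex A) * hψ.grad A ^ 2 := by
  refine Finset.sum_congr rfl fun A hA => ?_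
  rw [← measureReal_congr (interior_simplex_ae_eq A), ← smul_eq_mul, ← setIntegral_const]
  refine setIntegral_congr_fun isOpen_interior.measurableSet fun x hx => ?_
  have hd : HasFDerivAt ψ (LinearMap.toContinuousLinearMap (hψ.piece A).linear) x := by
    have h1 : HasFDerivAt (fun x => LinearMap.toContinuousLinearMap (hψ.piece A).linear x
        + hψ.piece A 0) (LinearMap.toContinuousLinearMap (hψ.piece A).linear) x :=
      (ContinuousLinearMap.hasFDerivAt _).add_const _
    refine h1.congr_of_eventuallyEq ?_
    filter_upwards [isOpen_interior.mem_nhds hx] with z hz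
    rw [hψ.eqOn_piece hA hz]
    have := (hψ.piece A).map_vadd 0 z
    simpa using this
  simp only [hd.fderiv, grad, gradNorm]
  rw [Real.sq_sqrt (by positivity)]
  rfl

/-- The jump of a Crouzeix–Raviart function across a face is controlled by the gradients. -/
lemma norm_jump_le (hψ : Th.IsCrouzeixRaviart ψ) (hA : A ∈ Th.cells) (hB : B ∈ Th.cells)
    (hAB : A ≠ B) (hF : F ∈ Th.triangles) (hFA : F ⊆ A) (hFB : F ⊆ B) {x : E3}
    (hx : x ∈ simplex F) :
    ‖hψ.piece A x - hψ.piece B x‖ ≤ (hψ.grad A + hψ.grad B) * simplexDiam F := by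
  obtain ⟨p, hp, hFp⟩ := exists_erase_eq hA hF hFA
  have hpos : 0 < (μHE[2] : Measure E3).real (simplex F) := hFp ▸ (isTet hA).area_face_pos hp
  have hfin : (μHE[2] : Measure E3) (simplex F) < ⊤ := hFp ▸ (isTet hA).area_face_lt_top hp
  set D : E3 → E3 := fun y => hψ.piece A y - hψ.piece B y with hD
  have hDc : Continuous D := (hψ.piece A).continuous_E3.sub (hψ.piece B).continuous_E3
  have hDi : IntegrableOn D (simplex F) μHE[2] :=
    hDc.continuousOn.integrableOn_of_subset_isCompact (isCompact_simplex F)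
      (measurableSet_simplex F) subset_rfl hfin.ne
  have h0 : ∫ y in simplex F, D y ∂μHE[2] = 0 := by
    rw [← hψ.jump_interior F hF A hA B hB hAB hFA hFB]
    refine setIntegral_congr_fun (measurableSet_simplex F) fun y hy => ?_
    rw [hψ.traceFrom_eq_piece hA (simplex_mono hFA hy), hψ.traceFrom_eq_piece hB
      (simplex_mono hFB hy)]
  -- The jump `D` has mean zero, so its size at `x` is bounded by its oscillation over the face.
  have h1 : ∫ y in simplex F, (D x - D y) ∂μHE[2] = (μHE[2] : Measure E3).real (simplex F) • D x := by
    have : IntegrableOn (fun _ => D x) (simplex F) μHE[2] := integrableOn_const hfin.ne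
    rw [integral_sub this hDi, h0, sub_zero, setIntegral_const]
  have h2 := norm_setIntegral_le_of_norm_le_const (μ := μHE[2]) (s := simplex F)
    (f := fun y => D x - D y) (C := (hψ.grad A + hψ.grad B) * simplexDiam F) hfin fun y hy => by
      have hxy := dist_le_simplexDiam hx hy
      have e : D x - D y = (hψ.piece A x - hψ.piece A y) - (hψ.piece B x - hψ.piece B y) := by
        simp only [hD]; abel
      rw [e, add_mul]
      exact (norm_sub_le _ _).trans (add_le_add (hψ.norm_piece_sub_le hxy)
        (hψ.norm_piece_sub_le hxy))
  rw [h1, norm_smul, Real.norm_of_nonneg hpos.le, mul_comm] at h2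
  exact le_of_mul_le_mul_right h2 hpos

open Classical in
/-- Comparison of the values of a Crouzeix–Raviart function along a segment that meets no edge. -/
lemma norm_piece_sub_piece_le (hψ : Th.IsCrouzeixRaviart ψ) (href : Th.IsRefinement TH)
    (hK : K ∈ TH.cells) (hA : A ∈ Th.cellsIn K) (hB : B ∈ Th.cellsIn K) {y z : E3}
    (hy : y ∈ simplex A) (hz : z ∈ simplex B) (hseg : ∀ x ∈ segment ℝ y z, x ∉ Th.edgeSet) :
    ‖hψ.piece A y - hψ.piece B z‖ ≤ 6 * ∑ G ∈ (Th.cellsIn K).filter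
      (fun G => (segment ℝ y z ∩ simplex G).Nonempty), simplexDiam G * hψ.grad G := by
  set M := (Th.cellsIn K).filter (fun G => (segment ℝ y z ∩ simplex G).Nonempty) with hM
  have hMK : ∀ G ∈ M, G ∈ Th.cells := fun G hG => (mem_cellsIn.1 (Finset.mem_filter.1 hG).1).1
  have hAM : A ∈ M := Finset.mem_filter.2 ⟨hA, y, left_mem_segment ℝ y z, hy⟩
  have hBM : B ∈ M := Finset.mem_filter.2 ⟨hB, z, right_mem_segment ℝ y z, hz⟩
  have hterm : ∀ G ∈ M, 0 ≤ simplexDiam G * hψ.grad G := fun G hG =>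
    mul_nonneg (isTet (hMK G hG)).diam_pos.le (hψ.grad_nonneg G)
  have hv : ∀ {G x}, G ∈ M → x ∈ simplex G →
      ‖hψ.piece G x - hψ.piece G (someVertex G)‖ ≤ simplexDiam G * hψ.grad G := by
    intro G x hG hx
    rw [mul_comm]
    exact hψ.norm_piece_sub_le (dist_le_simplexDiam hx
      (subset_simplex (someVertex_mem (isTet (hMK G hG)).nonempty)))
  -- Each cell met by the segment carries the value at a chosen vertex. Its weight 2h|∇ψ| pays for
  -- its share of a jump and for the move from the crossing point to the vertex. The two endpoints
  -- cost one more sum each, whence 2·2 + 1 + 1 = 6.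
  have key := norm_sub_le_sum_of_isPreconnected (ι := M) (S := segment ℝ y z)
    (I := fun G => simplex G) (v := fun G => hψ.piece G (someVertex G))
    (w := fun G => 2 * (simplexDiam G * hψ.grad G)) (convex_segment y z).isPreconnected
    (fun G => isClosed_simplex G) (fun G => (Finset.mem_filter.1 G.2).2)
    (fun x hx => by
      have hxK : x ∈ simplex K := (convex_simplex K).segment_subset ((mem_cellsIn.1 hA).2 hy)
        ((mem_cellsIn.1 hB).2 hz) hx
      obtain ⟨G, hG, hxG⟩ := exists_mem_cellsIn href hK hxK
      exact Set.mem_iUnion.2 ⟨⟨G, Finset.mem_filter.2 ⟨hG, x, hx, hxG⟩⟩, hxG⟩)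
    (fun G => mul_nonneg zero_le_two (hterm G G.2))
    (fun G₁ G₂ hne ⟨x, hx, hx₁, hx₂⟩ => by
      have hne' : (G₁ : Finset E3) ≠ G₂ := fun h => hne (Subtype.ext h)
      have hc₁ := hMK G₁ G₁.2
      have hc₂ := hMK G₂ G₂.2
      have hxi := mem_simplex_inter (mem_cells.1 hc₁).1 (mem_cells.1 hc₂).1 hx₁ hx₂
      have hlt := card_inter_lt (isTet hc₁).card (isTet hc₂).card hne'
      have hnon : ((G₁ : Finset E3) ∩ G₂).Nonempty := by
        rw [Finset.nonempty_iff_ne_empty]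
        intro h0
        rw [h0] at hxi
        simp [simplex] at hxi
      have hface := Th.complex.down_closed (mem_cells.1 hc₁).1
        (Finset.inter_subset_left (s₂ := (G₂ : Finset E3))) hnon
      -- As the segment avoids the edges, cells meeting on it share a whole triangle.
      have hF : (G₁ : Finset E3) ∩ G₂ ∈ Th.triangles := by
        refine mem_triangles.2 ⟨hface, ?_⟩
        by_contra h3
        exact hseg x hx (mem_edgeSet hface (by omega) hxi)
      have hj := hψ.norm_jump_le hc₁ hc₂ hne' hF Finset.inter_subset_left
        Finset.inter_subset_right hxi
      have hd₁ := simplexDiam_mono (simplex_mono (Finset.inter_subset_left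
        (s₁ := (G₁ : Finset E3)) (s₂ := G₂)))
      have hd₂ := simplexDiam_mono (simplex_mono (Finset.inter_subset_right
        (s₁ := (G₁ : Finset E3)) (s₂ := G₂)))
      have hj' : ‖hψ.piece G₁ x - hψ.piece G₂ x‖ ≤
          simplexDiam G₁ * hψ.grad G₁ + simplexDiam G₂ * hψ.grad G₂ := by
        refine hj.trans ?_
        rw [add_mul, mul_comm, mul_comm (hψ.grad G₂)]
        exact add_le_add (mul_le_mul_of_nonneg_right hd₁ (hψ.grad_nonneg _))
          (mul_le_mul_of_nonneg_right hd₂ (hψ.grad_nonneg _))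
      have hv₁ := hv G₁.2 hx₁
      have hv₂ := hv G₂.2 hx₂
      have e : hψ.piece G₁ (someVertex G₁) - hψ.piece G₂ (someVertex G₂) =
          (hψ.piece G₁ x - hψ.piece G₂ x) - (hψ.piece G₁ x - hψ.piece G₁ (someVertex G₁))
          + (hψ.piece G₂ x - hψ.piece G₂ (someVertex G₂)) := by abel
      rw [e]
      have := norm_add_le ((hψ.piece G₁ x - hψ.piece G₂ x)
        - (hψ.piece G₁ x - hψ.piece G₁ (someVertex G₁)))
        (hψ.piece G₂ x - hψ.piece G₂ (someVertex G₂))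
      have := norm_sub_le (hψ.piece G₁ x - hψ.piece G₂ x)
        (hψ.piece G₁ x - hψ.piece G₁ (someVertex G₁))
      linarith)
    ⟨A, hAM⟩ ⟨B, hBM⟩
  simp only at key
  rw [Finset.sum_coe_sort M fun G => 2 * (simplexDiam G * hψ.grad G), ← Finset.mul_sum] at key
  have hA1 := (hv hAM hy).trans (Finset.single_le_sum hterm hAM)
  have hB1 := (hv hBM hz).trans (Finset.single_le_sum hterm hBM)
  have e : hψ.piece A y - hψ.piece B z =
      (hψ.piece A y - hψ.piece A (someVertex A))
      + (hψ.piece A (someVertex A) - hψ.piece B (someVertex B))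
      - (hψ.piece B z - hψ.piece B (someVertex B)) := by abel
  rw [e]
  have := norm_sub_le ((hψ.piece A y - hψ.piece A (someVertex A))
      + (hψ.piece A (someVertex A) - hψ.piece B (someVertex B)))
      (hψ.piece B z - hψ.piece B (someVertex B))
  have := norm_add_le (hψ.piece A y - hψ.piece A (someVertex A))
      (hψ.piece A (someVertex A) - hψ.piece B (someVertex B))
  linarith

lemma ae_eq_piece (hψ : Th.IsCrouzeixRaviart ψ) (K : Finset E3) :
    ∀ᵐ z : E3, ∀ B ∈ Th.cellsIn K, z ∈ simplex B → ψ z = hψ.piece B z := by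
  rw [Filter.eventually_all_finset]
  intro B hB
  filter_upwards [(interior_simplex_ae_eq B).mem_iff] with z hz hzB
  exact hψ.eqOn_piece (mem_cellsIn.1 hB).1 (hz.2 hzB)

lemma integrableOn (hψ : Th.IsCrouzeixRaviart ψ) (href : Th.IsRefinement TH) (hK : K ∈ TH.cells) :
    IntegrableOn ψ (simplex K) := by
  have h1 : IntegrableOn ψ (⋃ A ∈ Th.cellsIn K, simplex A) := by
    rw [integrableOn_finset_iUnion]
    intro A hA
    have h2 : IntegrableOn (hψ.piece A) (simplex A) :=
      (hψ.piece A).continuous_E3.continuousOn.integrableOn_compact (isCompact_simplex A)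
    refine h2.congr_fun_ae ?_
    filter_upwards [ae_restrict_mem (measurableSet_simplex A),
      ae_restrict_of_ae (hψ.ae_eq_piece K)] with z hz hz'
    exact (hz' A hA hz).symm
  refine h1.mono_set fun x hx => ?_
  obtain ⟨A, hA, hxA⟩ := exists_mem_cellsIn href hK hx
  exact Set.mem_biUnion hA hxA

/-- The discrete Riesz potential of the gradient of a Crouzeix–Raviart function. -/
noncomputable def potential (hψ : Th.IsCrouzeixRaviart ψ) (K : Finset E3) (y : E3) : ℝ :=
  ∑ A ∈ Th.cellsIn K, simplexDiam A * hψ.grad A * aspect (simplexDiam A) (someVertex A) y ^ 4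

lemma potential_nonneg (hψ : Th.IsCrouzeixRaviart ψ) (K : Finset E3) (y : E3) :
    0 ≤ hψ.potential K y :=
  Finset.sum_nonneg fun A hA => mul_nonneg (mul_nonneg (isTet (mem_cellsIn.1 hA).1).diam_pos.le
    (hψ.grad_nonneg A)) (pow_nonneg (aspect_nonneg _ _ _) _)

lemma continuous_potential (hψ : Th.IsCrouzeixRaviart ψ) (K : Finset E3) :
    Continuous (hψ.potential K) :=
  continuous_finsetSum _ fun _ hA => continuous_const.mul
    ((continuous_aspect (isTet (mem_cellsIn.1 hA).1).diam_pos _).pow 4)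

/-- Off the edges, a Crouzeix–Raviart function differs from its mean over a coarse tetrahedron by
at most a multiple of the potential of its gradient. -/
lemma norm_piece_sub_average_le (hψ : Th.IsCrouzeixRaviart ψ) (href : Th.IsRefinement TH)
    (hK : K ∈ TH.cells) {σ r : ℝ} (hr : 0 < r) {c : E3} (hb : Metric.closedBall c r ⊆ simplex K)
    (hσ : simplexDiam K ≤ σ * (2 * r)) (hA : A ∈ Th.cellsIn K) {y : E3} (hy : y ∈ simplex A)
    (hye : y ∉ Th.edgeSet) :
    ‖hψ.piece A y - ⨍ z in simplex K, ψ z‖ ≤ 13824 * σ ^ 3 * hψ.potential K y := by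
  classical
  set R := simplexDiam K with hR
  have hR0 : 0 < R := (isTet hK).diam_pos
  have hκ := ballVolume_pos
  have hyK : y ∈ simplex K := (mem_cellsIn.1 hA).2 hy
  have hfin : volume (simplex K) ≠ ⊤ := (isCompact_simplex K).measure_lt_top.ne
  have hvol : ballVolume * r ^ 3 ≤ volume.real (simplex K) := by
    rw [measureReal_def, ← ENNReal.ofReal_le_iff_le_toReal hfin, ← volume_closedBall c hr.le]
    exact measure_mono hb
  have hVpos : 0 < volume.real (simplex K) := lt_of_lt_of_le (by positivity) hvol
  have hshadow : ∀ G : Finset E3, ∃ S : Set E3, G ∈ Th.cellsIn K → MeasurableSet S ∧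
      volume S ≤ ENNReal.ofReal (288 * ballVolume * R ^ 3 *
        aspect (simplexDiam G) (someVertex G) y ^ 4) ∧
      ∀ z ∈ Metric.closedBall y R, (segment ℝ y z ∩ Metric.closedBall (someVertex G)
        (simplexDiam G)).Nonempty → z ∈ S := by
    intro G
    by_cases hG : G ∈ Th.cellsIn K
    · obtain ⟨S, hS⟩ := exists_shadow y (someVertex G)
        (isTet (mem_cellsIn.1 hG).1).diam_pos hR0
      exact ⟨S, fun _ => hS⟩
    · exact ⟨∅, fun h => absurd h hG⟩
  choose S hS using hshadow
  set f : E3 → ℝ := fun z => 6 * ∑ G ∈ Th.cellsIn K,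
    (S G).indicator (fun _ => simplexDiam G * hψ.grad G) z with hf
  have hgn : ∀ G ∈ Th.cellsIn K, 0 ≤ simplexDiam G * hψ.grad G := fun G hG =>
    mul_nonneg (isTet (mem_cellsIn.1 hG).1).diam_pos.le (hψ.grad_nonneg G)
  have hfi : ∀ G ∈ Th.cellsIn K, IntegrableOn
      ((S G).indicator fun _ => simplexDiam G * hψ.grad G) (simplex K) := fun G hG =>
    (integrableOn_const hfin).indicator (hS G hG).1
  -- Each cell lies in the ball about its chosen vertex with radius its diameter, so it is met only
  -- if `z` is in the shadow of that ball.
  have hbound : ∀ᵐ z ∂volume.restrict (simplex K), ‖hψ.piece A y - ψ z‖ ≤ f z := by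
    filter_upwards [ae_restrict_mem (measurableSet_simplex K),
      ae_restrict_of_ae (hψ.ae_eq_piece K),
      ae_restrict_of_ae (Th.ae_segment_disjoint_edgeSet hye)] with z hzK hzp hzs
    obtain ⟨B, hB, hzB⟩ := exists_mem_cellsIn href hK hzK
    rw [hzp B hB hzB]
    refine (hψ.norm_piece_sub_piece_le href hK hA hB hy hzB hzs).trans ?_
    rw [hf]
    refine mul_le_mul_of_nonneg_left ?_ (by norm_num)
    rw [Finset.sum_filter]
    refine Finset.sum_le_sum fun G hG => ?_
    by_cases hm : (segment ℝ y z ∩ simplex G).Nonempty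
    · rw [if_pos hm, Set.indicator_of_mem]
      refine (hS G hG).2.2 z ?_ (hm.mono (Set.inter_subset_inter_right _ fun x hx => ?_))
      · exact mem_closedBall_iff_norm.2 (dist_le_simplexDiam hzK hyK)
      · exact mem_closedBall_iff_norm.2 (dist_le_simplexDiam hx
          (subset_simplex (someVertex_mem (isTet (mem_cellsIn.1 hG).1).nonempty)))
    · rw [if_neg hm]
      exact Set.indicator_nonneg (fun _ _ => hgn G hG) z
  have hψi := hψ.integrableOn href hK
  have hsub : ∫ z in simplex K, (hψ.piece A y - ψ z)
      = volume.real (simplex K) • (hψ.piece A y - ⨍ z in simplex K, ψ z) := by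
    have hci : IntegrableOn (fun _ => hψ.piece A y) (simplex K) := integrableOn_const hfin
    rw [integral_sub hci hψi, setIntegral_const, setAverage_eq, smul_sub, smul_smul,
      mul_inv_cancel₀ hVpos.ne', one_smul]
  have hint : ∫ z in simplex K, f z ≤ 6 * (288 * ballVolume * R ^ 3 * hψ.potential K y) := by
    rw [hf, integral_const_mul, integral_finsetSum _ hfi, potential,
      Finset.mul_sum _ _ (288 * ballVolume * R ^ 3)]
    refine mul_le_mul_of_nonneg_left (Finset.sum_le_sum fun G hG => ?_) (by norm_num)
    rw [integral_indicator_const _ (hS G hG).1, smul_eq_mul, mul_comm]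
    have h1 : (volume.restrict (simplex K)).real (S G) ≤ 288 * ballVolume * R ^ 3 *
        aspect (simplexDiam G) (someVertex G) y ^ 4 := by
      refine ENNReal.toReal_le_of_le_ofReal ?_ ((Measure.restrict_apply_le _ _).trans
        (hS G hG).2.1)
      have := aspect_nonneg (simplexDiam G) (someVertex G) y
      positivity
    calc _ ≤ simplexDiam G * hψ.grad G * (288 * ballVolume * R ^ 3 *
        aspect (simplexDiam G) (someVertex G) y ^ 4) := by
          exact mul_le_mul_of_nonneg_left h1 (hgn G hG)
      _ = _ := by ring
  have hmain := norm_integral_le_of_norm_le ((integrable_finsetSum _ hfi).const_mul 6) hbound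
  rw [hsub, norm_smul, Real.norm_of_nonneg hVpos.le] at hmain
  have hP := hψ.potential_nonneg K y
  -- Shape regularity of `K` compares R³ with its volume; the final constant is 6 · 288 · 8 = 13824.
  have hR3 : R ^ 3 ≤ 8 * σ ^ 3 * r ^ 3 := by
    calc R ^ 3 ≤ (σ * (2 * r)) ^ 3 := pow_le_pow_left₀ hR0.le hσ 3
      _ = _ := by ring
  have hσ0 : 0 < σ := by
    have := hR0.trans_le hσ
    exact pos_of_mul_pos_left this (by positivity)
  have : volume.real (simplex K) * ‖hψ.piece A y - ⨍ z in simplex K, ψ z‖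
      ≤ volume.real (simplex K) * (13824 * σ ^ 3 * hψ.potential K y) := by
    refine (hmain.trans hint).trans ?_
    calc 6 * (288 * ballVolume * R ^ 3 * hψ.potential K y)
        ≤ 6 * (288 * ballVolume * (8 * σ ^ 3 * r ^ 3) * hψ.potential K y) := by gcongr
      _ = (ballVolume * r ^ 3) * (13824 * σ ^ 3 * hψ.potential K y) := by ring
      _ ≤ _ := by gcongr
  exact le_of_mul_le_mul_left this hVpos

end Triangulation.IsCrouzeixRaviart

/-! ### Bounds of the potential in L² of cells and faces. -/

/-- The Cauchy–Schwarz inequality for the integral of a function against a finite measure. -/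
lemma sq_integral_le_mul_integral_sq {α : Type*} [MeasurableSpace α] {μ : Measure α}
    [IsFiniteMeasure μ] {f : α → ℝ} (hf : Integrable f μ) (hf2 : Integrable (fun x => f x ^ 2) μ) :
    (∫ x, f x ∂μ) ^ 2 ≤ μ.real Set.univ * ∫ x, f x ^ 2 ∂μ := by
  set m := μ.real Set.univ
  set I := ∫ x, f x ∂μ
  have hm0 : 0 ≤ m := measureReal_nonneg
  -- The variance, scaled by m² to avoid dividing by the total mass.
  have h : 0 ≤ ∫ x, (m * f x - I) ^ 2 ∂μ := integral_nonneg fun x => sq_nonneg _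
  have e : ∫ x, (m * f x - I) ^ 2 ∂μ = m * (m * ∫ x, f x ^ 2 ∂μ - I ^ 2) := by
    have e1 : (fun x => (m * f x - I) ^ 2) =
        fun x => m ^ 2 * f x ^ 2 - 2 * m * I * f x + I ^ 2 := by
      ext x; ring
    have i1 := hf2.const_mul (m ^ 2)
    have i2 := hf.const_mul (2 * m * I)
    have i3 : Integrable (fun x => m ^ 2 * f x ^ 2 - 2 * m * I * f x) μ := i1.sub i2
    rw [e1, integral_add i3 (integrable_const _), integral_sub i1 i2, integral_const_mul, integral_const_mul,
      integral_const, smul_eq_mul]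
    ring
  rw [e] at h
  rcases hm0.eq_or_lt with h0 | hpos
  · have : μ = 0 := by
      rw [← Measure.measure_univ_eq_zero]
      exact (measureReal_eq_zero_iff).1 h0.symm
    simp [I, this]
  · have := nonneg_of_mul_nonneg_right h hpos
    linarith

namespace Triangulation

variable {Ω : Set E3} {T TH Th : Triangulation Ω} {K A : Finset E3} {σ : ℝ}

lemma ShapeRegular.cube_diam_le (hσ : T.ShapeRegular σ) (hA : A ∈ T.cells) :
    simplexDiam A ^ 3 ≤ 8 * σ ^ 3 / ballVolume * volume.real (simplex A) := by
  obtain ⟨c, r, hr, hb, hd⟩ := hσ A hA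
  have hκ := ballVolume_pos
  have hd0 := (isTet hA).diam_pos
  have hσ0 : 0 < σ := pos_of_mul_pos_left (hd0.trans_le hd) (by positivity)
  have hvol : ballVolume * r ^ 3 ≤ volume.real (simplex A) := by
    rw [measureReal_def, ← ENNReal.ofReal_le_iff_le_toReal
      (isCompact_simplex A).measure_lt_top.ne, ← volume_closedBall c hr.le]
    exact measure_mono hb
  calc simplexDiam A ^ 3 ≤ (σ * (2 * r)) ^ 3 := pow_le_pow_left₀ hd0.le hd 3
    _ = 8 * σ ^ 3 / ballVolume * (ballVolume * r ^ 3) := by field_simp; ring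
    _ ≤ _ := by gcongr

lemma sum_setLIntegral_cellsIn_le (φ : E3 → ENNReal) :
    ∑ A ∈ T.cellsIn K, ∫⁻ x in simplex A, φ x ≤ ∫⁻ x in simplex K, φ x := by
  rw [Finset.sum_congr rfl fun A _ => (setLIntegral_congr (interior_simplex_ae_eq A)).symm,
    ← lintegral_biUnion_finset (fun A hA B hB hAB => disjoint_interior
      (mem_cellsIn.1 hA).1 (mem_cellsIn.1 hB).1 hAB) fun _ _ => isOpen_interior.measurableSet]
  exact lintegral_mono_set (Set.iUnion₂_subset fun A hA =>
    interior_subset.trans (mem_cellsIn.1 hA).2)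

/-- Comparison of a sum with an integral: for almost every x in `A` the term is at most h³|x -
y|^(-5/2), and h³ is at most a multiple of the volume of `A`. Averaging over the cells leaves the
integral of |x - y|^(-5/2) over `K`, finite because 5/2 < 3. -/
lemma ShapeRegular.sum_aspect_pow_five_le (hσ : T.ShapeRegular σ) (hσ0 : 0 < σ)
    (hK : 0 < simplexDiam K) {y : E3} (hy : y ∈ simplex K) :
    ∑ A ∈ T.cellsIn K, √(simplexDiam A) * aspect (simplexDiam A) (someVertex A) y ^ 5
      ≤ 512 * σ ^ 3 * √(simplexDiam K) := by
  have hκ := ballVolume_pos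
  set φ : E3 → ENNReal := fun x => ENNReal.ofReal ((√‖x - y‖)⁻¹ ^ 5) with hφ
  have hterm : ∀ A ∈ T.cellsIn K,
      ENNReal.ofReal (√(simplexDiam A) * aspect (simplexDiam A) (someVertex A) y ^ 5)
        ≤ ENNReal.ofReal (8 * σ ^ 3 / ballVolume) * ∫⁻ x in simplex A, φ x := by
    intro A hA
    have hAc := (mem_cellsIn.1 hA).1
    have hd0 := (isTet hAc).diam_pos
    have hasp := aspect_nonneg (simplexDiam A) (someVertex A) y
    have hvol0 : volume (simplex A) ≠ 0 :=
      ((isTet hAc).volume_interior_pos.trans_le (measure_mono interior_subset)).ne'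
    have hvolt : volume (simplex A) ≠ ⊤ := (isCompact_simplex A).measure_lt_top.ne
    have h1 : ENNReal.ofReal (√(simplexDiam A) * aspect (simplexDiam A) (someVertex A) y ^ 5)
        * volume (simplex A) ≤ ENNReal.ofReal (simplexDiam A ^ 3) * ∫⁻ x in simplex A, φ x := by
      rw [← setLIntegral_const, ← lintegral_const_mul' _ _ ENNReal.ofReal_ne_top]
      have hne : ∀ᵐ x : E3, x ≠ y := by simp [ae_iff]
      refine lintegral_mono_ae ?_
      filter_upwards [ae_restrict_mem (measurableSet_simplex A), ae_restrict_of_ae hne]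
        with x hx hxy
      rw [hφ, ← ENNReal.ofReal_mul (by positivity)]
      refine ENNReal.ofReal_le_ofReal ?_
      have h2 : aspect (simplexDiam A) (someVertex A) y ≤ √(simplexDiam A) * (√‖x - y‖)⁻¹ := by
        refine aspect_le hd0 ?_ (norm_pos_iff.2 (sub_ne_zero.2 hxy))
        have h3 := dist_le_simplexDiam hx (subset_simplex (someVertex_mem (isTet hAc).nonempty))
        have h4 := norm_sub_le_norm_sub_add_norm_sub x (someVertex A) y
        rw [norm_sub_rev (someVertex A)] at h4
        linarith
      calc √(simplexDiam A) * aspect (simplexDiam A) (someVertex A) y ^ 5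
          ≤ √(simplexDiam A) * (√(simplexDiam A) * (√‖x - y‖)⁻¹) ^ 5 := by gcongr
        _ = (√(simplexDiam A) ^ 2) ^ 3 * (√‖x - y‖)⁻¹ ^ 5 := by ring
        _ = _ := by rw [Real.sq_sqrt hd0.le]
    have h2 : ENNReal.ofReal (simplexDiam A ^ 3)
        ≤ ENNReal.ofReal (8 * σ ^ 3 / ballVolume) * volume (simplex A) := by
      rw [← ofReal_measureReal hvolt, ← ENNReal.ofReal_mul (by positivity)]
      exact ENNReal.ofReal_le_ofReal (hσ.cube_diam_le hAc)
    rw [← ENNReal.mul_le_mul_iff_left hvol0 hvolt]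
    refine h1.trans ((mul_le_mul_left h2 _).trans (le_of_eq ?_))
    ring
  have hnn : ∀ A ∈ T.cellsIn K,
      0 ≤ √(simplexDiam A) * aspect (simplexDiam A) (someVertex A) y ^ 5 := fun A _ =>
    mul_nonneg (Real.sqrt_nonneg _) (pow_nonneg (aspect_nonneg _ _ _) _)
  rw [← ENNReal.ofReal_le_ofReal_iff (by positivity), ENNReal.ofReal_sum_of_nonneg hnn]
  refine (Finset.sum_le_sum hterm).trans ?_
  rw [← Finset.mul_sum]
  have hKb : simplex K ⊆ Metric.closedBall y (simplexDiam K) := fun x hx =>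
    mem_closedBall_iff_norm.2 (dist_le_simplexDiam hx hy)
  have hpot : ∫⁻ x in simplex K, φ x ≤ ENNReal.ofReal (2 ^ (5 + 1) * ballVolume *
      √(simplexDiam K) ^ (2 * 3 - 5)) :=
    (lintegral_mono_set hKb).trans (lintegral_inv_sqrt_norm_pow_le (by norm_num) (by norm_num)
      hκ.le hK fun r hr => (volume_closedBall y hr.le).le)
  refine (mul_le_mul_right ((sum_setLIntegral_cellsIn_le φ).trans hpot) _).trans ?_
  rw [← ENNReal.ofReal_mul (by positivity)]
  refine ENNReal.ofReal_le_ofReal (le_of_eq ?_)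
  norm_num
  field_simp
  norm_num

namespace IsCrouzeixRaviart

variable {ψ : E3 → E3}

/-- The squared broken seminorm on a coarse tetrahedron, up to constants. -/
noncomputable def energy (hψ : Th.IsCrouzeixRaviart ψ) (K : Finset E3) : ℝ :=
  ∑ A ∈ Th.cellsIn K, simplexDiam A ^ 3 * hψ.grad A ^ 2

lemma energy_nonneg (hψ : Th.IsCrouzeixRaviart ψ) (K : Finset E3) : 0 ≤ hψ.energy K :=
  Finset.sum_nonneg fun _ hA => mul_nonneg
    (pow_nonneg (isTet (mem_cellsIn.1 hA).1).diam_pos.le _) (sq_nonneg _)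

lemma energy_le (hψ : Th.IsCrouzeixRaviart ψ) (hσ : Th.ShapeRegular σ) :
    hψ.energy K ≤ 8 * σ ^ 3 / ballVolume *
      ∑ A ∈ Th.cellsIn K, volume.real (simplex A) * hψ.grad A ^ 2 := by
  rw [energy, Finset.mul_sum]
  refine Finset.sum_le_sum fun A hA => ?_
  rw [← mul_assoc]
  exact mul_le_mul_of_nonneg_right (hσ.cube_diam_le (mem_cellsIn.1 hA).1) (sq_nonneg _)

/-- Cauchy–Schwarz with the fourth power of `aspect` split into exponents 5/2 and 3/2. After
squaring, the first factor decays like |x - y|^(-5/2), which is summable in three dimensions, and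
the second like |x - y|^(-3/2), which is integrable even on surfaces. -/
lemma sq_potential_le (hψ : Th.IsCrouzeixRaviart ψ) (hσ : Th.ShapeRegular σ) (hσ0 : 0 < σ)
    (hK : 0 < simplexDiam K) {y : E3} (hy : y ∈ simplex K) :
    hψ.potential K y ^ 2 ≤ 512 * σ ^ 3 * √(simplexDiam K) * ∑ A ∈ Th.cellsIn K,
      √(simplexDiam A) ^ 3 * hψ.grad A ^ 2 * aspect (simplexDiam A) (someVertex A) y ^ 3 := by
  have hasp := fun A : Finset E3 => aspect_nonneg (simplexDiam A) (someVertex A) y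
  have h1 := Finset.sum_sq_le_sum_mul_sum_of_sq_le_mul (Th.cellsIn K)
    (r := fun A => simplexDiam A * hψ.grad A * aspect (simplexDiam A) (someVertex A) y ^ 4)
    (f := fun A => √(simplexDiam A) * aspect (simplexDiam A) (someVertex A) y ^ 5)
    (g := fun A => √(simplexDiam A) ^ 3 * hψ.grad A ^ 2 *
      aspect (simplexDiam A) (someVertex A) y ^ 3)
    (fun A _ => mul_nonneg (Real.sqrt_nonneg _) (pow_nonneg (hasp A) _))
    (fun A _ => mul_nonneg (mul_nonneg (pow_nonneg (Real.sqrt_nonneg _) _) (sq_nonneg _))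
      (pow_nonneg (hasp A) _))
    (fun A hA => by
      have hd0 := (isTet (mem_cellsIn.1 hA).1).diam_pos
      have : simplexDiam A ^ 2 = √(simplexDiam A) ^ 4 := by
        rw [show 4 = 2 * 2 by norm_num, pow_mul, Real.sq_sqrt hd0.le]
      rw [mul_pow, mul_pow, this]
      exact le_of_eq (by ring))
  refine h1.trans (mul_le_mul_of_nonneg_right (hσ.sum_aspect_pow_five_le hσ0 hK hy) ?_)
  exact Finset.sum_nonneg fun A _ => mul_nonneg (mul_nonneg (pow_nonneg (Real.sqrt_nonneg _) _)
    (sq_nonneg _)) (pow_nonneg (hasp A) _)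

/-- The potential is bounded in `L²` for measures of dimension greater than `3 / 2`. -/
lemma integral_sq_potential_le (hψ : Th.IsCrouzeixRaviart ψ) (hσ : Th.ShapeRegular σ) (hσ0 : 0 < σ)
    (hK : 0 < simplexDiam K) {μ : Measure E3} [IsFiniteMeasure μ] {M : ℝ} {k : ℕ} (hk : 3 < 2 * k)
    (hM : 0 ≤ M) (hatom : ∀ c, μ {c} = 0)
    (hμ : ∀ c r, 0 < r → μ (Metric.closedBall c r) ≤ ENNReal.ofReal (M * r ^ k))
    (hsupp : ∀ᵐ y ∂μ, y ∈ simplex K) :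
    ∫ y, hψ.potential K y ^ 2 ∂μ ≤
      512 * σ ^ 3 * √(simplexDiam K) * (2 ^ 4 * M * √(simplexDiam K) ^ (2 * k - 3))
        * hψ.energy K := by
  have hint : ∀ A ∈ Th.cellsIn K, Integrable (fun y => √(simplexDiam A) ^ 3 * hψ.grad A ^ 2 *
      aspect (simplexDiam A) (someVertex A) y ^ 3) μ := fun A hA =>
    (integrable_aspect_pow (isTet (mem_cellsIn.1 hA).1).diam_pos _ 3).const_mul _
  refine (integral_mono_of_nonneg (.of_forall fun y => sq_nonneg _)
    ((integrable_finsetSum _ hint).const_mul (512 * σ ^ 3 * √(simplexDiam K)))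
    (hsupp.mono fun y hy => hψ.sq_potential_le hσ hσ0 hK hy)).trans ?_
  rw [integral_const_mul, integral_finsetSum _ hint, mul_assoc (512 * σ ^ 3 * √(simplexDiam K)),
    energy, Finset.mul_sum _ _ (2 ^ 4 * M * √(simplexDiam K) ^ (2 * k - 3))]
  refine mul_le_mul_of_nonneg_left (Finset.sum_le_sum fun A hA => ?_) (by positivity)
  have hAc := (mem_cellsIn.1 hA).1
  have hd0 := (isTet hAc).diam_pos
  have hv := (mem_cellsIn.1 hA).2 (subset_simplex (someVertex_mem (isTet hAc).nonempty))
  rw [integral_const_mul]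
  -- One factor h^(3/2) comes from Cauchy–Schwarz, the other from integrating the weight.
  have h3 : simplexDiam A ^ 3 = √(simplexDiam A) ^ 3 * √(simplexDiam A) ^ 3 := by
    rw [← mul_pow, Real.mul_self_sqrt hd0.le]
  calc √(simplexDiam A) ^ 3 * hψ.grad A ^ 2 *
        ∫ y, aspect (simplexDiam A) (someVertex A) y ^ 3 ∂μ
      ≤ √(simplexDiam A) ^ 3 * hψ.grad A ^ 2 *
        (√(simplexDiam A) ^ 3 * (2 ^ 4 * M * √(simplexDiam K) ^ (2 * k - 3))) := by
        refine mul_le_mul_of_nonneg_left ?_ (by positivity)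
        exact integral_aspect_pow_three_le hk hM hK hd0 (hatom _) (hμ _)
          (hsupp.mono fun y hy => mem_closedBall_iff_norm.2 (dist_le_simplexDiam hy hv))
    _ = _ := by rw [h3]; ring

lemma integral_cell_sq_potential_le (hψ : Th.IsCrouzeixRaviart ψ) (hσ : Th.ShapeRegular σ)
    (hσ0 : 0 < σ) (hK : 0 < simplexDiam K) :
    ∫ y in simplex K, hψ.potential K y ^ 2 ≤
      8192 * ballVolume * σ ^ 3 * simplexDiam K ^ 2 * hψ.energy K := by
  have hκ := ballVolume_pos
  have : IsFiniteMeasure ((volume : Measure E3).restrict (simplex K)) :=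
    isFiniteMeasure_restrict.2 (isCompact_simplex K).measure_lt_top.ne
  refine (hψ.integral_sq_potential_le hσ hσ0 hK (μ := volume.restrict (simplex K)) (k := 3)
    (M := ballVolume) (by norm_num) hκ.le (fun c => ?_) (fun c r hr => ?_)
    (ae_restrict_mem (measurableSet_simplex K))).trans (le_of_eq ?_)
  · exact measure_singleton c
  · exact (Measure.restrict_apply_le _ _).trans (volume_closedBall c hr.le).le
  · have : simplexDiam K ^ 2 = √(simplexDiam K) * √(simplexDiam K) ^ 3 := by
      rw [← pow_succ', show 3 + 1 = 2 * 2 by norm_num, pow_mul, Real.sq_sqrt hK.le]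
    rw [this, show 2 * 3 - 3 = 3 from rfl]; ring

/-- The case k = 2 replaces a trace inequality; the constant is 512 · 16 · 4, the 4 coming from the
area of ball sections. -/
lemma integral_face_sq_potential_le (hψ : Th.IsCrouzeixRaviart ψ) (hσ : Th.ShapeRegular σ)
    (hσ0 : 0 < σ) (hK : IsTet K) {P : E3} (hP : P ∈ K) :
    ∫ y in simplex (K.erase P), hψ.potential K y ^ 2 ∂μHE[2] ≤
      32768 * discArea * σ ^ 3 * simplexDiam K * hψ.energy K := by
  have hκ := discArea_pos
  have : IsFiniteMeasure ((μHE[2] : Measure E3).restrict (simplex (K.erase P))) :=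
    isFiniteMeasure_restrict.2 (hK.area_face_lt_top hP).ne
  refine (hψ.integral_sq_potential_le hσ hσ0 hK.diam_pos
    (μ := (μHE[2] : Measure E3).restrict (simplex (K.erase P))) (k := 2)
    (M := 4 * discArea) (by norm_num) (by positivity) (fun c => ?_) (fun c r hr => ?_)
    ?_).trans (le_of_eq ?_)
  · refine le_antisymm ((Measure.restrict_apply_le _ _).trans ?_) bot_le
    have := area_edge (e := {c}) (by simp)
    simpa [simplex] using this.le
  · rw [Measure.restrict_apply measurableSet_closedBall]
    exact hK.area_face_inter_closedBall_le hP c hr.le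
  · filter_upwards [ae_restrict_mem (measurableSet_simplex _)] with y hy
    exact simplex_mono (Finset.erase_subset _ _) hy
  · have : simplexDiam K = √(simplexDiam K) * √(simplexDiam K) :=
      (Real.mul_self_sqrt hK.diam_pos.le).symm
    rw [show 2 * 2 - 3 = 1 from rfl]
    conv_rhs => rw [this]
    ring

end IsCrouzeixRaviart

end Triangulation

/-! ### Existence of the Raviart–Thomas interpolant. -/

namespace IsTet

variable {K : Finset E3}

lemma inner_sub_eq_zero (h : IsTet K) {P n x y : E3} (hP : P ∈ K) (hn : IsUnitNormal (K.erase P) n)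
    (hx : x ∈ simplex (K.erase P)) (hy : y ∈ simplex (K.erase P)) : inner ℝ (x - y) n = 0 := by
  obtain ⟨q, hq⟩ := h.face_nonempty hP
  have h1 := h.face_subset_plane hP hq hn hx
  have h2 := h.face_subset_plane hP hq hn hy
  rw [Set.mem_ofPred_eq] at h1 h2
  rw [real_inner_comm, show x - y = (x - q) - (y - q) by abel, inner_sub_right, h1, h2, sub_zero]

/-- The normal component of a lowest-order Raviart–Thomas field is constant on a face. -/
lemma inner_eq_of_mem_face (h : IsTet K) {P n x y : E3} (hP : P ∈ K)
    (hn : IsUnitNormal (K.erase P) n) (hx : x ∈ simplex (K.erase P))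
    (hy : y ∈ simplex (K.erase P)) (a : E3) (b : ℝ) :
    inner ℝ (a + b • x) n = inner ℝ (a + b • y) n := by
  have h1 := h.inner_sub_eq_zero hP hn hx hy
  rw [← sub_eq_zero, ← inner_sub_left, show a + b • x - (a + b • y) = b • (x - y) by module,
    inner_smul_left, h1, mul_zero]

lemma setIntegral_inner_face (h : IsTet K) {P n x : E3} (hP : P ∈ K)
    (hn : IsUnitNormal (K.erase P) n) (hx : x ∈ simplex (K.erase P)) (a : E3) (b : ℝ) :
    ∫ y in simplex (K.erase P), inner ℝ (a + b • y) n ∂μHE[2]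
      = (μHE[2] : Measure E3).real (simplex (K.erase P)) * inner ℝ (a + b • x) n := by
  rw [setIntegral_congr_fun (measurableSet_simplex _)
    fun y hy => h.inner_eq_of_mem_face hP hn hy hx a b, setIntegral_const, smul_eq_mul]

/-- The normal fluxes through the faces of a tetrahedron can be prescribed by a lowest-order
Raviart–Thomas field. -/
lemma exists_raviartThomas (h : IsTet K) (g : E3 → E3) :
    ∃ (a : E3) (b : ℝ), ∀ P ∈ K, ∀ n, IsUnitNormal (K.erase P) n →
      ∫ y in simplex (K.erase P), inner ℝ (a + b • y) n ∂μHE[2]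
        = ∫ y in simplex (K.erase P), inner ℝ (g y) n ∂μHE[2] := by
  have hex : ∀ P : E3, ∃ n q : E3, P ∈ K → IsUnitNormal (K.erase P) n ∧ q ∈ K.erase P := by
    intro P
    by_cases hP : P ∈ K
    · obtain ⟨n, hn⟩ := h.exists_unitNormal hP
      obtain ⟨q, hq⟩ := h.face_nonempty hP
      exact ⟨n, q, fun _ => ⟨hn, hq⟩⟩
    · exact ⟨0, 0, fun hP' => absurd hP' hP⟩
  choose n q hnq using hex
  -- The field is Σ c_P (x - P). The summand of `P` is tangential to the faces through `P`, so it
  -- has flux only through the opposite face, and the system for the coefficients is diagonal.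
  set c : E3 → ℝ := fun P => (∫ y in simplex (K.erase P), inner ℝ (g y) (n P) ∂μHE[2]) /
    ((μHE[2] : Measure E3).real (simplex (K.erase P)) * inner ℝ (q P - P) (n P)) with hc
  refine ⟨-∑ P ∈ K, c P • P, ∑ P ∈ K, c P, fun P hP m hm => ?_⟩
  obtain ⟨hn, hq⟩ := hnq P hP
  obtain ⟨s, rfl⟩ := h.unitNormal_unique hP hn hm
  simp only [inner_smul_right]
  rw [integral_const_mul, integral_const_mul]
  congr 1
  rw [h.setIntegral_inner_face hP hn (subset_simplex hq)]
  have e1 : -∑ P ∈ K, c P • P + (∑ P ∈ K, c P) • q P = ∑ i ∈ K, c i • (q P - i) := by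
    simp only [smul_sub]
    rw [Finset.sum_sub_distrib, Finset.sum_smul]
    abel
  have hpos := h.area_face_pos hP
  have hne : inner ℝ (q P - P) (n P) ≠ 0 := by
    rw [real_inner_comm, ← neg_sub, inner_neg_right]
    exact neg_ne_zero.2 (h.inner_ne_zero hP hq hn)
  rw [e1, sum_inner, Finset.sum_eq_single_of_mem P hP]
  · rw [inner_smul_left, hc]
    simp only [conj_trivial]
    field_simp
  · intro i hi hiP
    rw [inner_smul_left, h.inner_sub_eq_zero hP hn (subset_simplex hq)
      (subset_simplex (Finset.mem_erase.2 ⟨hiP, hi⟩)), mul_zero]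

end IsTet

namespace Triangulation

variable {Ω : Set E3} {TH Th : Triangulation Ω} {ψ : E3 → E3} {K K₁ K₂ A F : Finset E3}

namespace IsCrouzeixRaviart

/-- The trace on a coarse face is given by the adjacent fine tetrahedra. -/
lemma traceFrom_coarse_eq (hψ : Th.IsCrouzeixRaviart ψ) (hK : K ∈ TH.cells) {P : E3} (hP : P ∈ K)
    (hA : A ∈ Th.cellsIn K) {y : E3} (hyF : y ∈ simplex (K.erase P)) (hyA : y ∈ simplex A)
    (hye : y ∉ Th.edgeSet) : traceFrom K ψ y = hψ.piece A y := by
  obtain ⟨a, -, -, -, -, hev⟩ := exists_fine_face hK hP hA hyF hyA hye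
  exact (isTet hK).traceFrom_eq (hψ.piece A).continuous_E3 (hψ.eqOn_piece (mem_cellsIn.1 hA).1)
    (simplex_mono (Finset.erase_subset _ _) hyF) hev

lemma ae_traceFrom_coarse_eq (hψ : Th.IsCrouzeixRaviart ψ) (hK : K ∈ TH.cells) {P : E3}
    (hP : P ∈ K) (hA : A ∈ Th.cellsIn K) {G : Finset E3}
    (hG : G ∈ Th.trianglesIn (K.erase P)) (hGA : G ⊆ A) :
    ∀ᵐ y ∂(μHE[2] : Measure E3).restrict (simplex G), traceFrom K ψ y = hψ.piece A y := by
  filter_upwards [ae_restrict_mem (measurableSet_simplex G),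
    ae_restrict_of_ae (measure_eq_zero_iff_ae_notMem.1 Th.area_edgeSet)] with y hy hye
  exact hψ.traceFrom_coarse_eq hK hP hA ((mem_trianglesIn.1 hG).2 hy) (simplex_mono hGA hy) hye

lemma integrableOn_piece_triangle (hψ : Th.IsCrouzeixRaviart ψ) (A : Finset E3)
    {G : Finset E3} (hG : G ∈ Th.triangles) :
    IntegrableOn (hψ.piece A) (simplex G) (μHE[2] : Measure E3) := by
  obtain ⟨B, hB, b, hb, rfl⟩ := exists_cell_of_triangle hG
  exact (hψ.piece A).continuous_E3.continuousOn.integrableOn_of_subset_isCompact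
    (isCompact_simplex _) (measurableSet_simplex _) subset_rfl ((isTet hB).area_face_lt_top hb).ne

lemma integrableOn_traceFrom_triangle (hψ : Th.IsCrouzeixRaviart ψ) (href : Th.IsRefinement TH)
    (hK : K ∈ TH.cells) {P : E3} (hP : P ∈ K) {G : Finset E3}
    (hG : G ∈ Th.trianglesIn (K.erase P)) :
    IntegrableOn (traceFrom K ψ) (simplex G) (μHE[2] : Measure E3) := by
  obtain ⟨A, hA, a, -, hGA, -⟩ := exists_cell_of_trianglesIn href hK hP hG
  exact (hψ.integrableOn_piece_triangle A (mem_trianglesIn.1 hG).1).congr_fun_ae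
    ((hψ.ae_traceFrom_coarse_eq hK hP hA hG (hGA ▸ Finset.erase_subset _ _)).mono
      fun _ h => h.symm)

lemma integrableOn_traceFrom (hψ : Th.IsCrouzeixRaviart ψ) (href : Th.IsRefinement TH)
    (hK : K ∈ TH.cells) {P : E3} (hP : P ∈ K) :
    IntegrableOn (traceFrom K ψ) (simplex (K.erase P)) (μHE[2] : Measure E3) :=
  integrableOn_face href hK hP fun _ hG => hψ.integrableOn_traceFrom_triangle href hK hP hG

/-- The mean jump across a coarse interior face vanishes. -/
lemma setIntegral_traceFrom_sub_eq_zero (hψ : Th.IsCrouzeixRaviart ψ) (href : Th.IsRefinement TH)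
    (h₁ : K₁ ∈ TH.cells) (h₂ : K₂ ∈ TH.cells) (hne : K₁ ≠ K₂) {P₁ P₂ : E3} (hP₁ : P₁ ∈ K₁)
    (hP₂ : P₂ ∈ K₂) (hF : K₁.erase P₁ = K₂.erase P₂) :
    ∫ y in simplex (K₁.erase P₁), (traceFrom K₁ ψ y - traceFrom K₂ ψ y) ∂μHE[2] = 0 := by
  refine setIntegral_face_eq_zero href h₁ hP₁ (fun G hG => ?_) fun G hG => ?_
  · exact (hψ.integrableOn_traceFrom_triangle href h₁ hP₁ hG).sub
      (hψ.integrableOn_traceFrom_triangle href h₂ hP₂ (hF ▸ hG))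
  · obtain ⟨A₁, hA₁, a₁, ha₁, hG₁, y, hyG, hye, hm₁⟩ :=
      exists_cell_of_trianglesIn href h₁ hP₁ hG
    have hG' := hG
    rw [hF] at hG'
    have hyF₂ := (mem_trianglesIn.1 hG').2 hyG
    obtain ⟨A₂, hA₂, hyA₂⟩ := exists_mem_cellsIn href h₂
      (simplex_mono (Finset.erase_subset _ _) hyF₂)
    obtain ⟨a₂, ha₂, -, hm₂, -, -⟩ := exists_fine_face h₂ hP₂ hA₂ hyF₂ hyA₂ hye
    have hGA₁ : G ⊆ A₁ := hG₁ ▸ Finset.erase_subset _ _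
    -- The fine cells on the two sides share `G`, so the coarse jump on `G` is the fine one, whose
    -- mean is zero.
    obtain ⟨hA, he⟩ := fine_face_eq h₁ h₂ hne hA₁ hA₂ ha₁ ha₂ (simplex_mono hGA₁ hyG) hyA₂ hm₁ hm₂
    have hGA₂ : G ⊆ A₂ := by rw [hG₁, he]; exact Finset.erase_subset _ _
    have hc₁ := (mem_cellsIn.1 hA₁).1
    have hc₂ := (mem_cellsIn.1 hA₂).1
    rw [← hψ.jump_interior G (mem_trianglesIn.1 hG).1 A₁ hc₁ A₂ hc₂ hA hGA₁ hGA₂]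
    refine integral_congr_ae ?_
    filter_upwards [ae_restrict_mem (measurableSet_simplex G),
      hψ.ae_traceFrom_coarse_eq h₁ hP₁ hA₁ hG hGA₁,
      hψ.ae_traceFrom_coarse_eq h₂ hP₂ hA₂ hG' hGA₂] with x hx e₁ e₂
    rw [e₁, e₂, hψ.traceFrom_eq_piece hc₁ (simplex_mono hGA₁ hx),
      hψ.traceFrom_eq_piece hc₂ (simplex_mono hGA₂ hx)]

/-- The mean trace on a coarse boundary face vanishes. -/
lemma setIntegral_traceFrom_boundary_eq_zero (hψ : Th.IsCrouzeixRaviart ψ)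
    (href : Th.IsRefinement TH) (hK : K ∈ TH.cells) {P : E3} (hP : P ∈ K)
    (hF : simplex (K.erase P) ⊆ frontier Ω) :
    ∫ y in simplex (K.erase P), traceFrom K ψ y ∂μHE[2] = 0 := by
  refine setIntegral_face_eq_zero href hK hP
    (fun G hG => hψ.integrableOn_traceFrom_triangle href hK hP hG) fun G hG => ?_
  obtain ⟨A, hA, a, ha, hGe, -⟩ := exists_cell_of_trianglesIn href hK hP hG
  have hGA : G ⊆ A := hGe ▸ Finset.erase_subset _ _
  obtain ⟨hGt, hGs⟩ := mem_trianglesIn.1 hG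
  have hc := (mem_cellsIn.1 hA).1
  rw [← hψ.jump_boundary G hGt (hGs.trans hF) A hc hGA]
  refine integral_congr_ae ?_
  filter_upwards [ae_restrict_mem (measurableSet_simplex G),
    hψ.ae_traceFrom_coarse_eq hK hP hA hG hGA] with x hx e
  rw [e, hψ.traceFrom_eq_piece hc (simplex_mono hGA hx)]

end IsCrouzeixRaviart

/-- The vanishing mean jump, tested with a constant vector: the prescribed fluxes do not depend on
the side. -/
lemma setIntegral_inner_traceFrom_eq (hψ : Th.IsCrouzeixRaviart ψ) (href : Th.IsRefinement TH)
    (h₁ : K₁ ∈ TH.cells) (h₂ : K₂ ∈ TH.cells) {P₁ P₂ : E3} (hP₁ : P₁ ∈ K₁)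
    (hP₂ : P₂ ∈ K₂) (hF : K₁.erase P₁ = K₂.erase P₂) (n : E3) :
    ∫ y in simplex (K₁.erase P₁), inner ℝ (traceFrom K₁ ψ y) n ∂μHE[2]
      = ∫ y in simplex (K₁.erase P₁), inner ℝ (traceFrom K₂ ψ y) n ∂μHE[2] := by
  by_cases hne : K₁ = K₂
  · rw [hne]
  · have i₁ := hψ.integrableOn_traceFrom href h₁ hP₁
    have i₂ : IntegrableOn (traceFrom K₂ ψ) (simplex (K₁.erase P₁)) (μHE[2] : Measure E3) :=
      hF ▸ hψ.integrableOn_traceFrom href h₂ hP₂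
    have h0 := hψ.setIntegral_traceFrom_sub_eq_zero href h₁ h₂ hne hP₁ hP₂ hF
    rw [integral_sub i₁ i₂, sub_eq_zero] at h0
    simp only [real_inner_comm n]
    rw [integral_inner i₁, integral_inner i₂, h0]

/-- The nodal Raviart–Thomas interpolant of a Crouzeix–Raviart function exists. -/
lemma IsCrouzeixRaviart.exists_isRTInterpolant (hψ : Th.IsCrouzeixRaviart ψ)
    (href : Th.IsRefinement TH) : ∃ v, TH.IsRTInterpolant ψ v := by
  classical
  have hloc : ∀ K : Finset E3, ∃ (a : E3) (b : ℝ), K ∈ TH.cells → ∀ P ∈ K, ∀ n,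
      IsUnitNormal (K.erase P) n →
      ∫ y in simplex (K.erase P), inner ℝ (a + b • y) n ∂μHE[2]
        = ∫ y in simplex (K.erase P), inner ℝ (traceFrom K ψ y) n ∂μHE[2] := by
    intro K
    by_cases hK : K ∈ TH.cells
    · obtain ⟨a, b, h⟩ := (isTet hK).exists_raviartThomas (traceFrom K ψ)
      exact ⟨a, b, fun _ => h⟩
    · exact ⟨0, 0, fun h => absurd h hK⟩
  choose a b hab using hloc
  -- The local fields are glued on the disjoint open cells; the value on the skeleton is arbitrary.
  set v : E3 → E3 := fun x =>
    if h : ∃ K ∈ TH.cells, x ∈ interior (simplex K) then a h.choose + b h.choose • x else 0 with hv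
  have hvK : ∀ K ∈ TH.cells, Set.EqOn v (fun x => a K + b K • x) (interior (simplex K)) := by
    intro K hK x hx
    have h : ∃ K ∈ TH.cells, x ∈ interior (simplex K) := ⟨K, hK, hx⟩
    have he : h.choose = K := by
      by_contra hne
      exact Set.disjoint_left.1 (disjoint_interior h.choose_spec.1 hK hne) h.choose_spec.2 hx
    simp only [hv, dif_pos h, he]
  have htr : ∀ K ∈ TH.cells, ∀ x ∈ simplex K, traceFrom K v x = a K + b K • x := fun K hK x hx =>
    (isTet hK).traceFrom_eq_self (p := fun x => a K + b K • x) (by fun_prop) (hvK K hK) hx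
  -- The normal component is constant on a face, so the flux determines it pointwise. Equal fluxes
  -- give continuity and zero flux gives the boundary condition.
  have hflux : ∀ K ∈ TH.cells, ∀ P ∈ K, ∀ n, IsUnitNormal (K.erase P) n →
      ∀ x ∈ simplex (K.erase P), (μHE[2] : Measure E3).real (simplex (K.erase P)) *
        inner ℝ (traceFrom K v x) n
          = ∫ y in simplex (K.erase P), inner ℝ (traceFrom K ψ y) n ∂μHE[2] := by
    intro K hK P hP n hn x hx
    rw [htr K hK x (simplex_mono (Finset.erase_subset _ _) hx), ← hab K hK P hP n hn,
      (isTet hK).setIntegral_inner_face hP hn hx]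
  refine ⟨v, ⟨fun K hK => ⟨a K, b K, hvK K hK⟩, ?_, ?_⟩, ?_, ?_⟩
  · intro F hF n hn K₁ h₁ K₂ h₂ hF₁ hF₂ x hx
    obtain ⟨P₁, hP₁, rfl⟩ := exists_erase_eq h₁ hF hF₁
    obtain ⟨P₂, hP₂, he⟩ := exists_erase_eq h₂ hF hF₂
    have e₁ := hflux K₁ h₁ P₁ hP₁ n hn x hx
    have e₂ := hflux K₂ h₂ P₂ hP₂ n (he ▸ hn) x (he ▸ hx)
    rw [← he, ← setIntegral_inner_traceFrom_eq hψ href h₁ h₂ hP₁ hP₂ he, ← e₁] at e₂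
    exact (mul_left_cancel₀ ((isTet h₁).area_face_pos hP₁).ne' e₂).symm
  · intro F hF hFb n hn K hK hFK x hx
    obtain ⟨P, hP, rfl⟩ := exists_erase_eq hK hF hFK
    have e := hflux K hK P hP n hn x hx
    simp only [real_inner_comm n] at e
    rw [integral_inner (hψ.integrableOn_traceFrom href hK hP),
      hψ.setIntegral_traceFrom_boundary_eq_zero href hK hP hFb, inner_zero_right] at e
    rw [real_inner_comm]
    exact (mul_eq_zero.1 e).resolve_left ((isTet hK).area_face_pos hP).ne'
  · intro K hK F hF hFK
    obtain ⟨P, hP, rfl⟩ := exists_erase_eq hK hF hFK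
    exact hψ.integrableOn_traceFrom href hK hP
  · intro K hK F hF hFK n hn
    obtain ⟨P, hP, rfl⟩ := exists_erase_eq hK hF hFK
    rw [← hab K hK P hP n hn]
    exact setIntegral_congr_fun (measurableSet_simplex _) fun x hx => by
      rw [htr K hK x (simplex_mono (Finset.erase_subset _ _) hx)]

end Triangulation

/-! ### The interpolation error. -/

namespace Triangulation

variable {Ω : Set E3} {TH Th : Triangulation Ω} {ψ : E3 → E3} {K : Finset E3} {σ : ℝ}

lemma IsCrouzeixRaviart.ae_norm_sub_average_le (hψ : Th.IsCrouzeixRaviart ψ)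
    (href : Th.IsRefinement TH) (hK : K ∈ TH.cells) {r : ℝ} (hr : 0 < r) {c : E3}
    (hb : Metric.closedBall c r ⊆ simplex K) (hd : simplexDiam K ≤ σ * (2 * r)) :
    ∀ᵐ y ∂volume.restrict (simplex K),
      ‖ψ y - ⨍ z in simplex K, ψ z‖ ≤ 13824 * σ ^ 3 * hψ.potential K y := by
  have hnull : volume Th.edgeSet = 0 := by
    refine (measure_biUnion_null_iff (Finset.countable_toSet _)).2 fun e he => ?_
    have := (Finset.mem_filter.1 he).2
    exact volume_simplex_of_card_le (by omega)
  filter_upwards [ae_restrict_mem (measurableSet_simplex K), ae_restrict_of_ae (hψ.ae_eq_piece K),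
    ae_restrict_of_ae (measure_eq_zero_iff_ae_notMem.1 hnull)] with y hyK hyp hye
  obtain ⟨A, hA, hyA⟩ := exists_mem_cellsIn href hK hyK
  rw [hyp A hA hyA]
  exact hψ.norm_piece_sub_average_le href hK hr hb hd hA hyA hye

lemma IsCrouzeixRaviart.ae_norm_traceFrom_sub_average_le (hψ : Th.IsCrouzeixRaviart ψ)
    (href : Th.IsRefinement TH) (hK : K ∈ TH.cells) {P : E3} (hP : P ∈ K) {r : ℝ} (hr : 0 < r)
    {c : E3} (hb : Metric.closedBall c r ⊆ simplex K) (hd : simplexDiam K ≤ σ * (2 * r)) :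
    ∀ᵐ y ∂(μHE[2] : Measure E3).restrict (simplex (K.erase P)),
      ‖traceFrom K ψ y - ⨍ z in simplex K, ψ z‖ ≤ 13824 * σ ^ 3 * hψ.potential K y := by
  filter_upwards [ae_restrict_mem (measurableSet_simplex (K.erase P)),
    ae_restrict_of_ae (measure_eq_zero_iff_ae_notMem.1 Th.area_edgeSet)] with y hyF hye
  obtain ⟨A, hA, hyA⟩ := exists_mem_cellsIn href hK (simplex_mono (Finset.erase_subset _ _) hyF)
  rw [hψ.traceFrom_coarse_eq hK hP hA hyF hyA hye]
  exact hψ.norm_piece_sub_average_le href hK hr hb hd hA hyA hye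

/-- The mean over a face of a Crouzeix–Raviart function is close to its mean over the
tetrahedron. -/
lemma IsCrouzeixRaviart.sq_setIntegral_inner_face_le (hψ : Th.IsCrouzeixRaviart ψ)
    (href : Th.IsRefinement TH) (hσh : Th.ShapeRegular σ) (hσ0 : 0 < σ) (hK : K ∈ TH.cells) {P : E3}
    (hP : P ∈ K) {r : ℝ} (hr : 0 < r) {c : E3} (hb : Metric.closedBall c r ⊆ simplex K)
    (hd : simplexDiam K ≤ σ * (2 * r)) {n : E3} (hn : ‖n‖ = 1) :
    (∫ y in simplex (K.erase P), inner ℝ (traceFrom K ψ y - ⨍ z in simplex K, ψ z) n ∂μHE[2]) ^ 2 ≤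
      (μHE[2] : Measure E3).real (simplex (K.erase P)) * ((13824 * σ ^ 3) ^ 2 *
        (32768 * discArea * σ ^ 3 * simplexDiam K * hψ.energy K)) := by
  have hT := isTet hK
  have hfin : (μHE[2] : Measure E3) (simplex (K.erase P)) ≠ ⊤ := (hT.area_face_lt_top hP).ne
  have : IsFiniteMeasure ((μHE[2] : Measure E3).restrict (simplex (K.erase P))) :=
    isFiniteMeasure_restrict.2 hfin
  have hpot : ∀ m : ℕ, Integrable (fun y => (13824 * σ ^ 3 * hψ.potential K y) ^ m)
      ((μHE[2] : Measure E3).restrict (simplex (K.erase P))) := fun m =>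
    ((continuous_const.mul (hψ.continuous_potential K)).pow
      m).continuousOn.integrableOn_of_subset_isCompact (isCompact_simplex _)
      (measurableSet_simplex _) subset_rfl hfin
  have h1 : ‖∫ y in simplex (K.erase P),
      inner ℝ (traceFrom K ψ y - ⨍ z in simplex K, ψ z) n ∂μHE[2]‖ ≤
      ∫ y in simplex (K.erase P), 13824 * σ ^ 3 * hψ.potential K y ∂μHE[2] := by
    refine norm_integral_le_of_norm_le (by simpa using hpot 1) ?_
    filter_upwards [hψ.ae_norm_traceFrom_sub_average_le href hK hP hr hb hd] with y hy
    exact (norm_inner_le_norm _ _).trans (by rwa [hn, mul_one])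
  have h2 := sq_integral_le_mul_integral_sq (by simpa using hpot 1) (hpot 2)
  rw [measureReal_restrict_apply_univ] at h2
  rw [← sq_abs, ← Real.norm_eq_abs]
  refine (pow_le_pow_left₀ (norm_nonneg _) h1 2).trans (h2.trans ?_)
  refine mul_le_mul_of_nonneg_left ?_ measureReal_nonneg
  simp only [mul_pow _ (hψ.potential K _)]
  rw [integral_const_mul]
  exact mul_le_mul_of_nonneg_left (hψ.integral_face_sq_potential_le hσh hσ0 hT hP) (sq_nonneg _)

/-- The constant in the local estimate of the interpolant. -/
noncomputable def interpolantConst (σ : ℝ) : ℝ := (13824 * σ ^ 3) ^ 2 * (131072 * σ ^ 5)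

/-- The interpolant is close to the mean of the interpolated function. -/
lemma IsRTInterpolant.sq_norm_sub_average_le {v : E3 → E3} (hv : TH.IsRTInterpolant ψ v)
    (hψ : Th.IsCrouzeixRaviart ψ) (href : Th.IsRefinement TH) (hσh : Th.ShapeRegular σ)
    (hσ0 : 0 < σ) (hK : K ∈ TH.cells) {r : ℝ} (hr : 0 < r) {c : E3}
    (hb : Metric.closedBall c r ⊆ simplex K) (hd : simplexDiam K ≤ σ * (2 * r)) {x : E3}
    (hx : x ∈ interior (simplex K)) :
    simplexDiam K * ‖v x - ⨍ z in simplex K, ψ z‖ ^ 2 ≤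
      16 * σ ^ 2 * interpolantConst σ * hψ.energy K := by
  have hT := isTet hK
  have hR0 := hT.diam_pos
  have hE := hψ.energy_nonneg K
  have hδ := discArea_pos
  set R := simplexDiam K with hR
  set m := ⨍ z in simplex K, ψ z with hm
  obtain ⟨a, b, hab⟩ := hv.mem.shape K hK
  set e := √(interpolantConst σ * hψ.energy K / R) with he
  have hC0 : 0 ≤ interpolantConst σ := by unfold interpolantConst; positivity
  -- The normal component of v - m is the face mean of that of ψ - m. The area of the face is at
  -- least that of a disc of radius `r`, comparable to R² by shape regularity.
  have hflux : ∀ P ∈ K, ∀ n, IsUnitNormal (K.erase P) n → ∀ y ∈ simplex (K.erase P),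
      |inner ℝ n (a + b • y - m)| ≤ e := by
    intro P hP n hn y hy
    have hfl := hv.flux K hK _ (face_mem_triangles hK hP) (Finset.erase_subset _ _) n hn
    have htr : ∀ z ∈ simplex (K.erase P), traceFrom K v z = a + b • z := fun z hz =>
      hT.traceFrom_eq_self (p := fun x => a + b • x) (by fun_prop) hab
        (simplex_mono (Finset.erase_subset _ _) hz)
    rw [setIntegral_congr_fun (measurableSet_simplex _)
      (fun z hz => by rw [htr z hz] : Set.EqOn _ (fun z => inner ℝ (a + b • z) n) _),
      hT.setIntegral_inner_face hP hn hy] at hfl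
    have hint := hψ.integrableOn_traceFrom href hK hP
    have hfin : (μHE[2] : Measure E3) (simplex (K.erase P)) ≠ ⊤ := (hT.area_face_lt_top hP).ne
    have hsq := hψ.sq_setIntegral_inner_face_le href hσh hσ0 hK hP hr hb hd hn.1
    set F := (μHE[2] : Measure E3).real (simplex (K.erase P)) with hF
    have hFpos : 0 < F := hT.area_face_pos hP
    have hI : ∫ y in simplex (K.erase P), inner ℝ (traceFrom K ψ y - m) n ∂μHE[2]
        = F * inner ℝ n (a + b • y - m) := by
      have i1 : IntegrableOn (fun y => inner ℝ (traceFrom K ψ y) n) (simplex (K.erase P))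
          (μHE[2] : Measure E3) := hint.inner_const n
      have i2 : IntegrableOn (fun _ : E3 => inner ℝ m n) (simplex (K.erase P))
          (μHE[2] : Measure E3) := integrableOn_const hfin
      simp only [inner_sub_left]
      rw [integral_sub i1 i2, ← hfl, setIntegral_const, smul_eq_mul, inner_sub_right, mul_sub,
        real_inner_comm n, real_inner_comm n]
    rw [hI, mul_pow] at hsq
    have hFr : discArea * r ^ 2 ≤ F := hT.le_area_face hP hr hb
    refine Real.abs_le_sqrt ?_
    rw [le_div_iff₀ hR0]
    have h1 : F * inner ℝ n (a + b • y - m) ^ 2 ≤ (13824 * σ ^ 3) ^ 2 *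
        (32768 * discArea * σ ^ 3 * R * hψ.energy K) := by
      refine le_of_mul_le_mul_left ?_ hFpos
      rwa [← mul_assoc, ← pow_two]
    have hRr : R ^ 2 ≤ 4 * σ ^ 2 * r ^ 2 := by
      calc R ^ 2 ≤ (σ * (2 * r)) ^ 2 := pow_le_pow_left₀ hR0.le hd 2
        _ = _ := by ring
    have hpos : 0 < discArea * r ^ 2 := by positivity
    refine le_of_mul_le_mul_left ?_ hpos
    set X := inner ℝ n (a + b • y - m) ^ 2 with hX
    have hX0 : 0 ≤ X := sq_nonneg _
    calc discArea * r ^ 2 * (X * R) ≤ F * X * R := by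
          rw [← mul_assoc]; gcongr
      _ ≤ (13824 * σ ^ 3) ^ 2 * (32768 * discArea * σ ^ 3 * R * hψ.energy K) * R := by gcongr
      _ = (13824 * σ ^ 3) ^ 2 * (32768 * discArea * σ ^ 3 * hψ.energy K) * R ^ 2 := by ring
      _ ≤ (13824 * σ ^ 3) ^ 2 * (32768 * discArea * σ ^ 3 * hψ.energy K) *
          (4 * σ ^ 2 * r ^ 2) := by gcongr
      _ = discArea * r ^ 2 * (interpolantConst σ * hψ.energy K) := by
          unfold interpolantConst; ring
  -- Three faces meet at `j`, and the normal component of v - m is at most `e` on each.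
  have hvert : ∀ j ∈ K, ‖a + b • j - m‖ ≤ 4 * σ * e := by
    intro j hj
    have he0 : 0 ≤ e := Real.sqrt_nonneg _
    refine (hT.norm_le_of_inner_le (e := e) hr hb hj fun p hp hpj => ?_).trans ?_
    · obtain ⟨n, hn⟩ := hT.exists_unitNormal hp
      exact ⟨n, hn, hflux p hp n hn j
        (subset_simplex (Finset.mem_erase.2 ⟨fun h => hpj h.symm, hj⟩))⟩
    · rw [← hR]
      calc 4 * (e / (2 * r) * R) ≤ 4 * (e / (2 * r) * (σ * (2 * r))) := by gcongr
        _ = 4 * σ * e := by field_simp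
  -- An affine field at `y` is a convex combination of its vertex values.
  have hall : ∀ y ∈ simplex K, ‖a + b • y - m‖ ≤ 4 * σ * e := by
    intro y hy
    rw [← hT.sum_bary_smul y]
    have e1 : a + b • ∑ p ∈ K, hT.bary p y • p - m
        = ∑ p ∈ K, hT.bary p y • (a + b • p - m) := by
      simp only [smul_sub, smul_add, Finset.sum_add_distrib, Finset.sum_sub_distrib,
        ← Finset.sum_smul, hT.sum_bary, one_smul, Finset.smul_sum, smul_comm b]
    rw [e1]
    have hnn := hT.mem_simplex_iff.1 hy
    calc ‖∑ p ∈ K, hT.bary p y • (a + b • p - m)‖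
        ≤ ∑ p ∈ K, hT.bary p y * (4 * σ * e) := norm_sum_le_of_le _ fun p hp => by
          rw [norm_smul, Real.norm_of_nonneg (hnn p hp)]
          exact mul_le_mul_of_nonneg_left (hvert p hp) (hnn p hp)
      _ = 4 * σ * e := by rw [← Finset.sum_mul, hT.sum_bary, one_mul]
  have hfinal := pow_le_pow_left₀ (norm_nonneg _) (hall x (interior_subset hx)) 2
  rw [hab hx]
  calc R * ‖a + b • x - m‖ ^ 2 ≤ R * (4 * σ * e) ^ 2 := by gcongr
    _ = R * (16 * σ ^ 2 * e ^ 2) := by ring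
    _ = _ := by
      rw [he, Real.sq_sqrt (by positivity)]
      field_simp

/-- The constant in the local interpolation error estimate. -/
noncomputable def localConst (σ : ℝ) : ℝ :=
  2 * ((13824 * σ ^ 3) ^ 2 * (8192 * ballVolume * σ ^ 3)) +
    2 * (16 * σ ^ 2 * interpolantConst σ * ballVolume)

/-- The interpolation error on a coarse tetrahedron. -/
lemma IsRTInterpolant.setIntegral_sq_norm_sub_le {v : E3 → E3} (hv : TH.IsRTInterpolant ψ v)
    (hψ : Th.IsCrouzeixRaviart ψ) (href : Th.IsRefinement TH) (hσh : Th.ShapeRegular σ)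
    (hσ0 : 0 < σ) (hσH : TH.ShapeRegular σ) (hK : K ∈ TH.cells) :
    ∫ x in simplex K, ‖ψ x - v x‖ ^ 2 ≤ localConst σ * simplexDiam K ^ 2 * hψ.energy K := by
  obtain ⟨c, r, hr, hb, hd⟩ := hσH K hK
  have hT := isTet hK
  have hR0 := hT.diam_pos
  have hE := hψ.energy_nonneg K
  have hκ := ballVolume_pos
  have hC0 : 0 ≤ interpolantConst σ := by unfold interpolantConst; positivity
  have hcpt := isCompact_simplex K
  set R := simplexDiam K with hR
  set m := ⨍ z in simplex K, ψ z with hm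
  set B := 16 * σ ^ 2 * interpolantConst σ * hψ.energy K / R with hB
  have hpi : IntegrableOn (fun y => (13824 * σ ^ 3) ^ 2 * hψ.potential K y ^ 2) (simplex K) :=
    (continuous_const.mul ((hψ.continuous_potential K).pow 2)).continuousOn.integrableOn_compact
      hcpt
  have hBi : IntegrableOn (fun _ : E3 => B) (simplex K) :=
    integrableOn_const hcpt.measure_lt_top.ne
  have hsum : IntegrableOn (fun y => 2 * ((13824 * σ ^ 3) ^ 2 * hψ.potential K y ^ 2) + 2 * B)
      (simplex K) := (hpi.const_mul 2).add (hBi.const_mul 2)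
  -- The error is split at the mean: ψ - m is bounded by the potential and v - m by a constant.
  have hpt : ∀ᵐ y ∂volume.restrict (simplex K), ‖ψ y - v y‖ ^ 2 ≤
      2 * ((13824 * σ ^ 3) ^ 2 * hψ.potential K y ^ 2) + 2 * B := by
    filter_upwards [hψ.ae_norm_sub_average_le href hK hr hb hd,
      ae_restrict_mem (measurableSet_simplex K),
      ae_restrict_of_ae (interior_simplex_ae_eq K).mem_iff] with y hy hyK hyi
    have h1 := pow_le_pow_left₀ (norm_nonneg _) hy 2
    have h2 : ‖v y - m‖ ^ 2 ≤ B := by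
      rw [hB, le_div_iff₀ hR0, mul_comm]
      exact hv.sq_norm_sub_average_le hψ href hσh hσ0 hK hr hb hd (hyi.2 hyK)
    have h3 : ‖ψ y - v y‖ ≤ ‖ψ y - m‖ + ‖v y - m‖ := by
      rw [show ψ y - v y = (ψ y - m) - (v y - m) by abel]
      exact norm_sub_le _ _
    have h4 := pow_le_pow_left₀ (norm_nonneg _) h3 2
    rw [mul_pow] at h1
    nlinarith [sq_nonneg (‖ψ y - m‖ - ‖v y - m‖)]
  have hvol : volume.real (simplex K) ≤ ballVolume * R ^ 3 := by
    obtain ⟨q, hq⟩ := hT.nonempty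
    refine ENNReal.toReal_le_of_le_ofReal (by positivity) ?_
    rw [← volume_closedBall q hR0.le]
    exact measure_mono fun x hx => mem_closedBall_iff_norm.2
      (dist_le_simplexDiam hx (subset_simplex hq))
  calc ∫ x in simplex K, ‖ψ x - v x‖ ^ 2
      ≤ ∫ y in simplex K, (2 * ((13824 * σ ^ 3) ^ 2 * hψ.potential K y ^ 2) + 2 * B) :=
        integral_mono_of_nonneg (.of_forall fun _ => sq_nonneg _) hsum hpt
    _ = 2 * ((13824 * σ ^ 3) ^ 2 * ∫ y in simplex K, hψ.potential K y ^ 2)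
          + volume.real (simplex K) * (2 * B) := by
        rw [integral_add (hpi.const_mul 2) (hBi.const_mul 2), integral_const_mul,
          integral_const_mul, setIntegral_const, smul_eq_mul]
    _ ≤ 2 * ((13824 * σ ^ 3) ^ 2 * (8192 * ballVolume * σ ^ 3 * R ^ 2 * hψ.energy K))
          + ballVolume * R ^ 3 * (2 * B) := by
        have hB0 : 0 ≤ B := by positivity
        have := hψ.integral_cell_sq_potential_le hσh hσ0 hR0
        gcongr
    _ = _ := by
        rw [hB, localConst]
        field_simp

/-- No fine cell is counted twice, since it has interior points and distinct coarse cells have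
disjoint interiors. -/
lemma sum_cellsIn_le {f : Finset E3 → ℝ}
    (hf : ∀ A ∈ Th.cells, 0 ≤ f A) :
    ∑ K ∈ TH.cells, ∑ A ∈ Th.cellsIn K, f A ≤ ∑ A ∈ Th.cells, f A := by
  classical
  rw [← Finset.sum_biUnion]
  · refine Finset.sum_le_sum_of_subset_of_nonneg (fun A hA => ?_) fun A hA _ => hf A hA
    obtain ⟨K, -, hAK⟩ := Finset.mem_biUnion.1 hA
    exact (mem_cellsIn.1 hAK).1
  · intro K₁ h₁ K₂ h₂ hne
    refine Finset.disjoint_left.2 fun A hA₁ hA₂ => ?_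
    obtain ⟨hA, hs₁⟩ := mem_cellsIn.1 hA₁
    obtain ⟨x, hx⟩ := (isTet hA).interior_nonempty
    exact Set.disjoint_left.1 (disjoint_interior h₁ h₂ hne) (interior_mono hs₁ hx)
      (interior_mono (mem_cellsIn.1 hA₂).2 hx)

end Triangulation

theorem lemma5p1 (σ : ℝ) :
    ∃ C : ℝ, 0 < C ∧
      ∀ (Ω : Set E3) (TH Th : Triangulation Ω),
        TH.ShapeRegular σ → Th.ShapeRegular σ → Th.IsRefinement TH →
        ∀ ψ : E3 → E3, Th.IsCrouzeixRaviart ψ →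
          (∃ v : E3 → E3, TH.IsRTInterpolant ψ v) ∧
          ∀ v : E3 → E3, TH.IsRTInterpolant ψ v →
            (∑ K ∈ TH.cells, (simplexDiam K ^ 2)⁻¹ * (∫ x in simplex K, ‖ψ x - v x‖ ^ 2))
              ≤ C * Th.brokenSeminormSq ψ := by
  -- The absolute value and the summand 1 keep the constant positive for every real `σ`. Positivity
  -- of `σ` itself follows from shape regularity as soon as there is a cell.
  refine ⟨|Triangulation.localConst σ * (8 * σ ^ 3 / ballVolume)| + 1, by positivity, ?_⟩
  intro Ω TH Th hσH hσh href ψ hψ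
  refine ⟨hψ.exists_isRTInterpolant href, fun v hv => ?_⟩
  have hnn : ∀ A : Finset E3, 0 ≤ volume.real (simplex A) * hψ.grad A ^ 2 := fun A =>
    mul_nonneg measureReal_nonneg (sq_nonneg _)
  have hκ := ballVolume_pos
  rw [hψ.brokenSeminormSq_eq]
  set C := |Triangulation.localConst σ * (8 * σ ^ 3 / ballVolume)| + 1 with hC
  have hC0 : 0 < C := by positivity
  calc ∑ K ∈ TH.cells, (simplexDiam K ^ 2)⁻¹ * (∫ x in simplex K, ‖ψ x - v x‖ ^ 2)
      ≤ ∑ K ∈ TH.cells, C * ∑ A ∈ Th.cellsIn K, volume.real (simplex A) * hψ.grad A ^ 2 := by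
        refine Finset.sum_le_sum fun K hK => ?_
        obtain ⟨c, r, hr, -, hd⟩ := hσH K hK
        have hR0 := (Triangulation.isTet hK).diam_pos
        have hσ0 : 0 < σ := pos_of_mul_pos_left (hR0.trans_le hd) (by positivity)
        have hL0 : 0 ≤ Triangulation.localConst σ := by
          unfold Triangulation.localConst Triangulation.interpolantConst; positivity
        rw [inv_mul_le_iff₀ (by positivity)]
        refine (hv.setIntegral_sq_norm_sub_le hψ href hσh hσ0 hσH hK).trans ?_
        set S := ∑ A ∈ Th.cellsIn K, volume.real (simplex A) * hψ.grad A ^ 2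
        have hS0 : 0 ≤ S := Finset.sum_nonneg fun A _ => hnn A
        calc Triangulation.localConst σ * simplexDiam K ^ 2 * hψ.energy K
            ≤ Triangulation.localConst σ * simplexDiam K ^ 2 * (8 * σ ^ 3 / ballVolume * S) := by
              gcongr
              exact hψ.energy_le hσh
          _ = simplexDiam K ^ 2 * ((Triangulation.localConst σ * (8 * σ ^ 3 / ballVolume)) * S) := by
              ring
          _ ≤ simplexDiam K ^ 2 * (C * S) := by
              gcongr
              rw [hC]
              linarith [le_abs_self (Triangulation.localConst σ * (8 * σ ^ 3 / ballVolume))]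
    _ = C * ∑ K ∈ TH.cells, ∑ A ∈ Th.cellsIn K, volume.real (simplex A) * hψ.grad A ^ 2 := by
        rw [Finset.mul_sum]
    _ ≤ C * ∑ A ∈ Th.cells, volume.real (simplex A) * hψ.grad A ^ 2 :=
        mul_le_mul_of_nonneg_left (Triangulation.sum_cellsIn_le fun A _ => hnn A) hC0.le
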